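/- Let $A\in\mathbb R^{n\times n}$ be a nonsingular primitive matrix, i.e. $A$ is entrywise nonnegative, irreducible, and has exactly one eigenvalue of maximum modulus. Let $A$ have $r_1$ distinct positive eigenvalues, $r_2$ distinct negative eigenvalues and $c$ distinct pairs of complex-conjugate non-real eigenvalues, and let $p>1$ be an integer. A real matrix $X$ is eventually positive if there is $N\ge 0$ such that $X^k$ is entrywise positive for all $k\ge N$. For $z=re^{\mathrm i\theta}$ with $r>0$, $-\pi<\theta\le\pi$, let $f_j(z)=r^{1/p}e^{\mathrm i(\theta+2\pi j)/p}$, $j=0,\dots,p-1$, be the branches of the $p$-th root, with $$f_j^{(k)}(z)=\frac1{p^k}\prod_{i=0}^{k-1}(1-ip)\; r^{(1-kp)/p}e^{\mathrm i[2\pi j+\theta(1-kp)]/p}.$$ For the $m\times m$ Jordan block $J_m(\lambda)$ with $\lambda\ne0$, let $f_j(J_m(\lambda))$ be the upper triangular Toeplitz matrix with entries $f_j^{(k)}(\lambda)/k!$ on the $k$-th superdiagonal. A primary $p$-th root of $A$ is a matrix $X$ with $X^p=A$ of the form $X=Z\bigl(\bigoplus_{i=1}^t f_{j_i}(J_{n_i}(\lambda_i))\bigr)Z^{-1}$,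 where $A=Z\bigl(\bigoplus_{i=1}^t J_{n_i}(\lambda_i)\bigr)Z^{-1}$ is a Jordan canonical form of $A$ over $\mathbb C$ and $j_1,\dots,j_t\in\{0,\dots,p-1\}$ satisfy $j_i=j_k$ whenever $\lambda_i=\lambda_k$. If $p$ is even, then $A$ has (a) exactly $2^{r_1-1}p^c$ eventually positive primary $p$-th roots when $r_2=0$, and (b) no eventually positive primary $p$-th roots when $r_2>0$. If $p$ is odd, then $A$ has exactly $p^c$ eventually positive primary $p$-th roots. -/

import Mathlib

open Matrix

namespace MatrixRoot

noncomputable section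

/-- The complex matrix with the same entries as a given real matrix. -/
def toComplex {n : ℕ} (A : Matrix (Fin n) (Fin n) ℝ) : Matrix (Fin n) (Fin n) ℂ :=
  A.map Complex.ofReal

/-- A real square matrix is eventually positive if all its powers from some exponent on
are entrywise positive. -/
def EventuallyPositive {n : ℕ} (X : Matrix (Fin n) (Fin n) ℝ) : Prop :=
  ∃ N : ℕ, ∀ k ≥ N, ∀ i j, 0 < (X ^ k) i j

/-- A square matrix is reducible if a simultaneous permutation of its rows and columns makes it
block upper triangular, with two square nonempty diagonal blocks. -/
def Reducible {n : ℕ} (A : Matrix (Fin n) (Fin n) ℝ) : Prop :=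
  ∃ (k l : ℕ) (e : Fin k ⊕ Fin l ≃ Fin n), 0 < k ∧ 0 < l ∧ (A.submatrix e e).toBlocks₂₁ = 0

/-- A primitive matrix: entrywise nonnegative, irreducible, and with exactly one (complex)
eigenvalue of maximum modulus. -/
structure Primitive {n : ℕ} (A : Matrix (Fin n) (Fin n) ℝ) : Prop where
  nonneg : ∀ i j, 0 ≤ A i j
  irreducible : ¬ Reducible A
  existsUnique_max : ∃! z : ℂ, z ∈ spectrum ℂ (toComplex A) ∧
    ∀ w ∈ spectrum ℂ (toComplex A), ‖w‖ ≤ ‖z‖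

/-- The `m × m` upper triangular Jordan block with eigenvalue `z`. -/
def jordanBlock (m : ℕ) (z : ℂ) : Matrix (Fin m) (Fin m) ℂ :=
  Matrix.of fun a b => if a = b then z else if (a : ℕ) + 1 = b then 1 else 0

/-- The branch `f_j` of the `p`-th root function,
`f_j (r exp (i θ)) = r ^ (1 / p) exp (i (θ + 2 π j) / p)` with `r > 0` and `-π < θ ≤ π`. -/
def rootBranch (p j : ℕ) (z : ℂ) : ℂ :=
  ((‖z‖ ^ (1 / (p : ℝ)) : ℝ) : ℂ) *
    Complex.exp (Complex.I * ((Complex.arg z + 2 * Real.pi * j) / p : ℝ))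

/-- The `k`-th derivative of the branch `f_j` of the `p`-th root function at `z ≠ 0`, by its
closed formula. On the negative real axis, where the argument jumps, this is the derivative of
the branch that is continued analytically across the axis from above. -/
def rootBranchDeriv (p j k : ℕ) (z : ℂ) : ℂ :=
  1 / (p : ℂ) ^ k * (∏ i ∈ Finset.range k, (1 - (i : ℂ) * p)) *
    (((‖z‖ ^ ((1 - (k : ℝ) * p) / p) : ℝ) : ℂ) *
      Complex.exp (Complex.I *
        ((2 * Real.pi * j + Complex.arg z * (1 - (k : ℝ) * p)) / p : ℝ)))

theorem rootBranchDeriv_zero (p j : ℕ) (z : ℂ) :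
    rootBranchDeriv p j 0 z = rootBranch p j z := by
  simp [rootBranchDeriv, rootBranch, add_comm]

/-- The matrix function `f_j` at the Jordan block `jordanBlock m z`: the upper triangular Toeplitz
matrix with entries `f_j^{(k)} (z) / k!` on the `k`-th superdiagonal. -/
def rootJordanBlock (p j m : ℕ) (z : ℂ) : Matrix (Fin m) (Fin m) ℂ :=
  Matrix.of fun a b =>
    if a ≤ b then rootBranchDeriv p j ((b : ℕ) - a) z / (((b : ℕ) - a).factorial : ℂ) else 0

/-- `X` is a primary `p`-th root of the nonsingular matrix `A`: it is a `p`-th root of `A`, and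
for a Jordan canonical form `A = Z (⊕ J_{m i} (ev i)) Z⁻¹` (with `Zinv = Z⁻¹`) it is
`X = Z (⊕ f_{j i} (J_{m i} (ev i))) Z⁻¹`, where the same branch is taken for any two Jordan blocks
that have the same eigenvalue. -/
def IsPrimaryRoot {n : ℕ} (p : ℕ) (A X : Matrix (Fin n) (Fin n) ℂ) : Prop :=
  X ^ p = A ∧
  ∃ (t : ℕ) (m : Fin t → ℕ) (ev : Fin t → ℂ)
    (Z : Matrix (Fin n) (Σ i, Fin (m i)) ℂ) (Zinv : Matrix (Σ i, Fin (m i)) (Fin n) ℂ)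
    (j : Fin t → ℕ),
    (∀ i, 0 < m i) ∧ Z * Zinv = 1 ∧ Zinv * Z = 1 ∧
    A = Z * Matrix.blockDiagonal' (fun i => jordanBlock (m i) (ev i)) * Zinv ∧
    (∀ i, j i < p) ∧ (∀ i k, ev i = ev k → j i = j k) ∧
    X = Z * Matrix.blockDiagonal' (fun i => rootJordanBlock p (j i) (m i) (ev i)) * Zinv

/-- The set of eventually positive primary `p`-th roots of a real matrix `A`. -/
def evPosPrimaryRoots {n : ℕ} (p : ℕ) (A : Matrix (Fin n) (Fin n) ℝ) :
    Set (Matrix (Fin n) (Fin n) ℝ) :=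
  {X | IsPrimaryRoot p (toComplex A) (toComplex X) ∧ EventuallyPositive X}

end

end MatrixRoot

/-!
A primary `p`-th root `X` of `A` acts on the generalized eigenspace of `A` at each eigenvalue `z` as
a power series in `A - z`, which is nilpotent there: the Taylor series at `z` of one branch of the
`p`-th root (`isPrimaryRoot_iff`). That series is `w (1 + (A - z) / z) ^ (1 / p)`, so it is fixed by
the value `w` of the branch, and `w` can be any number with `w ^ p = z`. Generalized
eigenvectors span, so `X` amounts to a function `μ` on the spectrum with `μ z ^ p = z` (`IsBranchRoot.unique`,
`IsBranchRoot.eqOn`, `exists_isBranchRoot`), whatever Jordan form was used to write it. That the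
powers of the series behave as expected is the functional equation of the binomial series, read
through upper triangular Toeplitz matrices; that a Jordan form exists is the structure theorem for
`ℂ[X]`-modules.

Complex conjugation replaces `μ` by `z ↦ conj (μ (conj z))`, so `X` is real exactly if `μ` commutes
with conjugation (`map_conj_eq_iff`). In particular `μ` is real at real eigenvalues, and it is
determined by its values in the closed upper half plane.

By the Perron–Frobenius theorem (`perron_frobenius`) the dominant eigenvalue of `A` is a number
`r > 0`, and `A ^ k / r ^ k` converges to an entrywise positive matrix whose columns are
eigenvectors at `r`. As `X ^ (s + p k) = X ^ s A ^ k`, this makes a real root `X` eventually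
positive exactly if `μ r > 0` (`eventuallyPositive_iff`).

It remains to count the functions `μ`, independently at each eigenvalue in the closed upper half
plane: `p` values at a non-real one, one at `r`, and at any other real eigenvalue the number of its
real `p`-th roots. For odd `p` this is one. For even `p` it is two or zero according to the sign.
-/

namespace MatrixRoot

noncomputable section

open Filter Topology
open scoped ComplexConjugate

/-! ### Toeplitz matrices and branches of the root -/

/-- The upper triangular Toeplitz matrix whose `k`-th superdiagonal carries the `k`-th coefficient
of a power series; equivalently, the power series evaluated at the nilpotent Jordan block. -/
def toeplitz (m : ℕ) (s : PowerSeries ℂ) : Matrix (Fin m) (Fin m) ℂ :=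
  Matrix.of fun a b => if a ≤ b then PowerSeries.coeff ((b : ℕ) - a) s else 0

theorem toeplitz_one (m : ℕ) : toeplitz m 1 = 1 := by
  ext a b
  simp only [toeplitz, Matrix.of_apply, PowerSeries.coeff_one, Matrix.one_apply, Fin.ext_iff,
    Fin.le_def]
  grind

theorem toeplitz_mul (m : ℕ) (s t : PowerSeries ℂ) :
    toeplitz m (s * t) = toeplitz m s * toeplitz m t := by
  ext a c
  simp only [toeplitz, Matrix.of_apply, Matrix.mul_apply, PowerSeries.coeff_mul]
  have key : ∀ b : Fin m, ((if a ≤ b then PowerSeries.coeff ((b : ℕ) - a) s else 0) *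
      if b ≤ c then PowerSeries.coeff ((c : ℕ) - b) t else 0) =
      if a ≤ b ∧ b ≤ c then
        PowerSeries.coeff ((b : ℕ) - a) s * PowerSeries.coeff ((c : ℕ) - b) t else 0 := by
    intro b
    split_ifs <;> simp_all
  simp only [key]
  rw [← Finset.sum_filter]
  split_ifs with hac
  · have hac' : (a : ℕ) ≤ c := hac
    have hc := c.2
    refine Finset.sum_bij' (fun x hx => ⟨a + x.1, ?_⟩)
      (fun b _ => ((b : ℕ) - a, (c : ℕ) - b)) ?_ ?_ ?_ ?_ ?_
    · rw [Finset.HasAntidiagonal.mem_antidiagonal] at hx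
      omega
    · intro x hx
      rw [Finset.HasAntidiagonal.mem_antidiagonal] at hx
      simp only [Finset.mem_filter, Finset.mem_univ, true_and, Fin.le_def]
      omega
    · intro b hb
      simp only [Finset.mem_filter, Finset.mem_univ, true_and, Fin.le_def] at hb
      rw [Finset.HasAntidiagonal.mem_antidiagonal]
      omega
    · intro x hx
      rw [Finset.HasAntidiagonal.mem_antidiagonal] at hx
      simp only [Prod.ext_iff]
      omega
    · intro b hb
      simp only [Finset.mem_filter, Finset.mem_univ, true_and, Fin.le_def] at hb
      simp only [Fin.ext_iff]
      omega
    · intro x hx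
      rw [Finset.HasAntidiagonal.mem_antidiagonal] at hx
      rw [show (a : ℕ) + x.1 - a = x.1 by omega, show (c : ℕ) - (a + x.1) = x.2 by omega]
  · rw [Finset.filter_false_of_mem, Finset.sum_empty]
    exact fun b _ h => hac (h.1.trans h.2)

theorem toeplitz_pow (m : ℕ) (s : PowerSeries ℂ) (k : ℕ) :
    toeplitz m (s ^ k) = toeplitz m s ^ k := by
  induction k with
  | zero => simp [toeplitz_one]
  | succ k ih => rw [pow_succ, pow_succ, toeplitz_mul, ih]

theorem toeplitz_C_add_X (m : ℕ) (z : ℂ) :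
    toeplitz m (PowerSeries.C z + PowerSeries.X) = jordanBlock m z := by
  ext a b
  simp only [toeplitz, jordanBlock, Matrix.of_apply, map_add, PowerSeries.coeff_C,
    PowerSeries.coeff_X, Fin.ext_iff, Fin.le_def]
  grind

theorem toeplitz_X (m : ℕ) (z : ℂ) :
    toeplitz m PowerSeries.X = jordanBlock m z - z • (1 : Matrix (Fin m) (Fin m) ℂ) := by
  rw [← toeplitz_C_add_X]
  ext a b
  simp only [toeplitz, Matrix.of_apply, map_add, PowerSeries.coeff_C, PowerSeries.coeff_X,
    Fin.le_def, Matrix.sub_apply, Matrix.smul_apply, Matrix.one_apply, Fin.ext_iff, smul_eq_mul]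
  grind

/-- A Toeplitz matrix is the truncated Taylor polynomial of its series at the Jordan block; any
truncation order that is at least the size of the block will do. -/
theorem sum_smul_jordanBlock_pow {m n : ℕ} (hmn : m ≤ n) (z : ℂ) (s : PowerSeries ℂ) :
    ∑ k ∈ Finset.range n, PowerSeries.coeff k s •
      (jordanBlock m z - z • (1 : Matrix (Fin m) (Fin m) ℂ)) ^ k = toeplitz m s := by
  simp only [← toeplitz_X m z, ← toeplitz_pow]
  ext a b
  simp only [Matrix.sum_apply, Matrix.smul_apply, toeplitz, Matrix.of_apply,
    PowerSeries.coeff_X_pow]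
  split_ifs with hab
  · rw [Finset.sum_eq_single ((b : ℕ) - a)]
    · simp
    · intro k _ hk
      simp [hk.symm]
    · intro h
      exact absurd (Finset.mem_range.2 (by have := b.2; omega)) h
  · simp

/-- The Taylor series at `z` of the branch of the `p`-th root function with value `w` at `z`, where
`w ^ p = z`: the series `w (1 + X / z) ^ (1 / p)`. -/
def rootSeries (p : ℕ) (z w : ℂ) : PowerSeries ℂ :=
  PowerSeries.C w * PowerSeries.rescale z⁻¹ (PowerSeries.binomialSeries ℂ (1 / p : ℚ))

theorem coeff_rootSeries (p : ℕ) (z w : ℂ) (k : ℕ) :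
    PowerSeries.coeff k (rootSeries p z w) = w * (z⁻¹ ^ k * (Ring.choose (1 / p : ℚ) k : ℚ)) := by
  simp [rootSeries, PowerSeries.coeff_rescale, Rat.smul_def]

theorem binomialSeries_nsmul (r : ℚ) (k : ℕ) :
    PowerSeries.binomialSeries ℂ (k * r) = PowerSeries.binomialSeries ℂ r ^ k := by
  induction k with
  | zero => simp
  | succ k ih => rw [pow_succ, ← ih, ← PowerSeries.binomialSeries_add]; congr 1; push_cast; ring

theorem rootSeries_pow {p : ℕ} (hp : p ≠ 0) {z w : ℂ} (hz : z ≠ 0) (hw : w ^ p = z) :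
    rootSeries p z w ^ p = PowerSeries.C z + PowerSeries.X := by
  have h1 : PowerSeries.binomialSeries ℂ (1 / p : ℚ) ^ p = 1 + PowerSeries.X := by
    rw [← binomialSeries_nsmul, mul_one_div_cancel (by exact_mod_cast hp)]
    simpa using PowerSeries.binomialSeries_nat (R := ℚ) (A := ℂ) 1
  rw [rootSeries, mul_pow, ← map_pow, ← map_pow, h1, hw, map_add, map_one, PowerSeries.rescale_X,
    mul_add, mul_one, ← mul_assoc, ← map_mul, mul_inv_cancel₀ hz, map_one, one_mul]

theorem conj_coeff_rootSeries (p : ℕ) (z w : ℂ) (k : ℕ) :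
    conj (PowerSeries.coeff k (rootSeries p z w)) =
      PowerSeries.coeff k (rootSeries p (conj z) (conj w)) := by
  simp only [coeff_rootSeries, map_mul, map_pow, map_inv₀]
  congr 2
  simp

/-- The numerical factor in the closed formula of `rootBranchDeriv`, divided by `k!`, is a
binomial coefficient. -/
theorem choose_one_div (p : ℕ) (hp : p ≠ 0) (k : ℕ) :
    Ring.choose (1 / p : ℚ) k =
      1 / (p : ℚ) ^ k * (∏ i ∈ Finset.range k, (1 - (i : ℚ) * p)) / (k.factorial : ℚ) := by
  have hp' : (p : ℚ) ≠ 0 := by exact_mod_cast hp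
  have h : (descPochhammer ℤ k).smeval (1 / p : ℚ) =
      1 / (p : ℚ) ^ k * (∏ i ∈ Finset.range k, (1 - (i : ℚ) * p)) := by
    induction k with
    | zero => simp
    | succ k ih =>
      rw [descPochhammer_succ_right, Polynomial.smeval_mul, ih, Finset.prod_range_succ]
      simp only [Polynomial.smeval_sub, Polynomial.smeval_X, Polynomial.smeval_natCast, pow_one,
        pow_zero, nsmul_eq_mul, mul_one]
      rw [show (1 / p - k : ℚ) = 1 / p * (1 - k * p) by field_simp]
      ring
  rw [Ring.choose_eq_smul, h, smul_eq_mul]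
  ring

theorem norm_mul_exp_neg_arg (z : ℂ) (k : ℕ) :
    ((‖z‖ ^ k : ℝ) : ℂ)⁻¹ * Complex.exp (-(k * (Complex.I * Complex.arg z))) = z⁻¹ ^ k := by
  conv_rhs => rw [← Complex.norm_mul_exp_arg_mul_I z]
  rw [Complex.exp_neg, Complex.exp_nat_mul, inv_pow, mul_pow, mul_inv, mul_comm Complex.I]
  push_cast
  rfl

theorem rootBranchDeriv_div_factorial {p : ℕ} (hp : p ≠ 0) (j k : ℕ) {z : ℂ} (hz : z ≠ 0) :
    rootBranchDeriv p j k z / (k.factorial : ℂ) =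
      PowerSeries.coeff k (rootSeries p z (rootBranch p j z)) := by
  have hp' : (p : ℝ) ≠ 0 := by exact_mod_cast hp
  have hpc : (p : ℂ) ≠ 0 := by exact_mod_cast hp
  rw [coeff_rootSeries, choose_one_div p hp, ← norm_mul_exp_neg_arg z, rootBranch,
    rootBranchDeriv]
  have h1 : ‖z‖ ^ ((1 - (k : ℝ) * p) / p) = ‖z‖ ^ (1 / (p : ℝ)) * (‖z‖ ^ k)⁻¹ := by
    rw [show (1 - (k : ℝ) * p) / p = 1 / p - k by field_simp,
      Real.rpow_sub_natCast (by simpa using hz)]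
    rfl
  have h2 : Complex.exp (Complex.I *
      ((2 * Real.pi * j + Complex.arg z * (1 - (k : ℝ) * p)) / p : ℝ)) =
      Complex.exp (Complex.I * ((Complex.arg z + 2 * Real.pi * j) / p : ℝ)) *
        Complex.exp (-(k * (Complex.I * Complex.arg z))) := by
    rw [← Complex.exp_add]
    congr 1
    push_cast
    field_simp
    ring
  rw [h1, h2]
  push_cast
  ring

theorem rootJordanBlock_eq_toeplitz {p : ℕ} (hp : p ≠ 0) (j m : ℕ) {z : ℂ} (hz : z ≠ 0) :
    rootJordanBlock p j m z = toeplitz m (rootSeries p z (rootBranch p j z)) := by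
  ext a b
  simp only [rootJordanBlock, toeplitz, Matrix.of_apply, rootBranchDeriv_div_factorial hp j _ hz]

theorem rootBranch_pow {p : ℕ} (hp : p ≠ 0) (j : ℕ) (z : ℂ) : rootBranch p j z ^ p = z := by
  have hpc : (p : ℂ) ≠ 0 := by exact_mod_cast hp
  rw [rootBranch, mul_pow, ← Complex.ofReal_pow, ← Real.rpow_natCast, ← Real.rpow_mul (by simp),
    one_div_mul_cancel (by exact_mod_cast hp), Real.rpow_one, ← Complex.exp_nat_mul]
  conv_rhs => rw [← Complex.norm_mul_exp_arg_mul_I z]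
  congr 1
  rw [Complex.exp_eq_exp_iff_exists_int]
  refine ⟨j, ?_⟩
  push_cast
  field_simp

theorem rootBranch_eq_mul {p : ℕ} (hp : p ≠ 0) (j : ℕ) (z : ℂ) :
    rootBranch p j z =
      rootBranch p 0 z * Complex.exp (2 * Real.pi * Complex.I / p) ^ j := by
  have hpc : (p : ℂ) ≠ 0 := by exact_mod_cast hp
  rw [rootBranch, rootBranch, mul_assoc (((‖z‖ ^ (1 / (p : ℝ)) : ℝ) : ℂ)),
    ← Complex.exp_nat_mul, ← Complex.exp_add]
  congr 2
  push_cast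
  field_simp
  ring

/-- Every `p`-th root of a nonzero number is the value of one of the branches. -/
theorem exists_rootBranch_eq {p : ℕ} (hp : p ≠ 0) {z w : ℂ} (hz : z ≠ 0) (hw : w ^ p = z) :
    ∃ j < p, rootBranch p j z = w := by
  have h0 : rootBranch p 0 z ≠ 0 := by
    intro h
    have := rootBranch_pow hp 0 z
    rw [h, zero_pow hp] at this
    exact hz this.symm
  have : NeZero p := ⟨hp⟩
  obtain ⟨j, hj, h⟩ := (Complex.isPrimitiveRoot_exp p hp).eq_pow_of_pow_eq_one
    (ξ := w / rootBranch p 0 z) (by rw [div_pow, hw, rootBranch_pow hp, div_self hz])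
  refine ⟨j, hj, ?_⟩
  rw [rootBranch_eq_mul hp, h, mul_div_cancel₀ _ h0]

/-! ### The Jordan canonical form -/

open Polynomial in
theorem exists_span_pow_eq {q : ℂ[X]} (hq : Irreducible q) (e : ℕ) :
    ∃ z : ℂ, Submodule.span ℂ[X] {q ^ e} = Ideal.span {(X - C z) ^ e} := by
  obtain ⟨z, hz⟩ := Complex.exists_root (Polynomial.degree_pos_of_irreducible hq)
  refine ⟨z, Ideal.span_singleton_eq_span_singleton.2 ?_⟩
  exact (((irreducible_X_sub_C z).associated_of_dvd hq (dvd_iff_isRoot.2 hz)).symm).pow_pow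

open Polynomial in
/-- The powers of `X - z` in descending order form a Jordan basis of `ℂ[X] / (X - z) ^ e`. -/
theorem exists_basis_quotient (I : Ideal ℂ[X]) (z : ℂ) (e : ℕ)
    (hI : I = Ideal.span {(X - C z) ^ e}) :
    ∃ b : Module.Basis (Fin e) ℂ (ℂ[X] ⧸ I),
      ∀ k, b k = Ideal.Quotient.mk I ((X - C z) ^ (e - 1 - k)) := by
  let v : Fin e → ℂ[X] ⧸ I := fun k => Ideal.Quotient.mk I ((X - C z) ^ (e - 1 - k : ℕ))
  have hspan : ⊤ ≤ Submodule.span ℂ (Set.range v) := by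
    rintro x -
    obtain ⟨f, rfl⟩ := Ideal.Quotient.mk_surjective x
    rw [← sum_taylor_eq f z, Polynomial.sum, map_sum]
    refine Submodule.sum_mem _ fun i _ => ?_
    have hmul : Ideal.Quotient.mk I (C ((taylor z f).coeff i) * (X - C z) ^ i) =
        (taylor z f).coeff i • Ideal.Quotient.mk I ((X - C z) ^ i) := by
      rw [← smul_eq_C_mul]
      rfl
    rw [hmul]
    refine Submodule.smul_mem _ _ ?_
    by_cases hi : i < e
    · refine Submodule.subset_span ⟨⟨e - 1 - i, by omega⟩, ?_⟩
      simp only [v]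
      congr 2
      omega
    · rw [Ideal.Quotient.eq_zero_iff_mem.2]
      · exact Submodule.zero_mem _
      · rw [hI, Ideal.mem_span_singleton]
        exact pow_dvd_pow _ (by omega)
  have hrank : Fintype.card (Fin e) = Module.finrank ℂ (ℂ[X] ⧸ I) := by
    subst hI
    rw [finrank_quotient_span_eq_natDegree, natDegree_pow, natDegree_X_sub_C, Fintype.card_fin,
      mul_one]
  exact ⟨basisOfTopLeSpanOfCardEqFinrank v hspan hrank, fun k => by simp [v]⟩

open Polynomial in
/-- Multiplication by `X` has the matrix of a Jordan block in the basis of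
`exists_basis_quotient`. -/
theorem X_smul_mk (I : Ideal ℂ[X]) (z : ℂ) (e : ℕ) (hI : I = Ideal.span {(X - C z) ^ e})
    (b : Module.Basis (Fin e) ℂ (ℂ[X] ⧸ I))
    (hb : ∀ k, b k = Ideal.Quotient.mk I ((X - C z) ^ (e - 1 - k : ℕ))) (k : Fin e) :
    (X : ℂ[X]) • b k = ∑ l, jordanBlock e z l k • b l := by
  have hk := k.2
  have hX : ∀ f : ℂ[X], (X : ℂ[X]) • Ideal.Quotient.mk I f =
      z • Ideal.Quotient.mk I f + Ideal.Quotient.mk I ((X - C z) * f) := by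
    intro f
    have h1 : z • Ideal.Quotient.mk I f = Ideal.Quotient.mk I (C z * f) := by
      rw [← smul_eq_C_mul]; rfl
    rw [h1, ← map_add]
    change Ideal.Quotient.mk I (X * f) = _
    congr 1
    ring
  rw [hb k, hX, ← pow_succ', ← hb k]
  rcases Nat.eq_zero_or_pos (k : ℕ) with h0 | h0
  · have hzero : Ideal.Quotient.mk I ((X - C z) ^ (e - 1 - k + 1 : ℕ)) = 0 := by
      rw [Ideal.Quotient.eq_zero_iff_mem, hI, Ideal.mem_span_singleton]
      exact pow_dvd_pow _ (by omega)
    rw [hzero, add_zero, Finset.sum_eq_single k]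
    · simp [jordanBlock]
    · intro l _ hl
      simp [jordanBlock, hl, h0]
    · simp
  · let k' : Fin e := ⟨k - 1, by omega⟩
    have hne : k ≠ k' := by
      simp only [k', ne_eq, Fin.ext_iff]
      omega
    have hprev : Ideal.Quotient.mk I ((X - C z) ^ (e - 1 - k + 1 : ℕ)) = b k' := by
      rw [hb]
      congr 2
      simp only [k']
      omega
    rw [hprev, Finset.sum_eq_add k k' hne]
    · have h1 : (k' : ℕ) + 1 = k := by simp only [k']; omega
      simp [jordanBlock, hne.symm, h1]
    · intro l _ hl
      have h1 : ¬ (l : ℕ) + 1 = k := by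
        intro h
        exact hl.2 (Fin.ext (by simp only [k']; omega))
      simp [jordanBlock, hl.1, h1]
    · simp
    · simp

open Polynomial in
/-- The Jordan canonical form over `ℂ`, from the structure theorem for the torsion `ℂ[X]`-module
on which `X` acts as `A`. -/
theorem exists_jordan_form {n : ℕ} (A : Matrix (Fin n) (Fin n) ℂ) :
    ∃ (t : ℕ) (m : Fin t → ℕ) (ev : Fin t → ℂ)
      (Z : Matrix (Fin n) (Σ i, Fin (m i)) ℂ) (Zinv : Matrix (Σ i, Fin (m i)) (Fin n) ℂ),
      (∀ i, 0 < m i) ∧ Z * Zinv = 1 ∧ Zinv * Z = 1 ∧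
      A = Z * Matrix.blockDiagonal' (fun i => jordanBlock (m i) (ev i)) * Zinv := by
  classical
  let φ : (Fin n → ℂ) →ₗ[ℂ] (Fin n → ℂ) := Matrix.toLin' A
  obtain ⟨ι, _, q, hq, e, ⟨E⟩⟩ := Module.equiv_directSum_of_isTorsion
    (R := ℂ[X]) (M := Module.AEval' φ)
    (Module.AEval.isTorsion_of_finiteDimensional ℂ (Fin n → ℂ) φ)
  choose z hz using fun i => exists_span_pow_eq (hq i) (e i)
  choose b hb using fun i => exists_basis_quotient _ (z i) (e i) (hz i)
  -- the blocks of size zero, which the structure theorem allows, carry no basis vectors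
  let ι' := {i // 0 < e i}
  let σ : Fin (Fintype.card ι') ≃ ι' := (Fintype.equivFin ι').symm
  let E' : (Fin n → ℂ) ≃ₗ[ℂ] (∀ i, ℂ[X] ⧸ Submodule.span ℂ[X] {q i ^ e i}) :=
    (Module.AEval'.of φ).trans ((E.trans
      (DirectSum.linearEquivFunOnFintype ℂ[X] ι _)).restrictScalars ℂ)
  have hE' : ∀ v, E' (A *ᵥ v) = (X : ℂ[X]) • E' v := by
    intro v
    have : Module.AEval'.of φ (A *ᵥ v) = (X : ℂ[X]) • Module.AEval'.of φ v := by
      rw [Module.AEval'.X_smul_of]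
      rfl
    simp only [E', LinearEquiv.trans_apply, LinearEquiv.restrictScalars_apply, this, map_smul]
  let τ : (Σ i, Fin (e i)) ≃ (Σ i : Fin (Fintype.card ι'), Fin (e (σ i))) :=
    { toFun := fun x => ⟨σ.symm ⟨x.1, x.2.pos⟩, Fin.cast (by simp) x.2⟩
      invFun := fun x => ⟨σ x.1, x.2⟩
      left_inv := by
        rintro ⟨i, x⟩
        have hi : (σ (σ.symm ⟨i, x.pos⟩) : ι) = i := by simp
        refine Sigma.ext hi ?_
        rw [Fin.heq_ext_iff]
        · simp
        · simp
      right_inv := by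
        rintro ⟨i, x⟩
        refine Sigma.ext (by simp) ?_
        rw [Fin.heq_ext_iff]
        · simp
        · simp }
  let B : Module.Basis (Σ i : Fin (Fintype.card ι'), Fin (e (σ i))) ℂ (Fin n → ℂ) :=
    ((Pi.basis b).map E'.symm).reindex τ
  have hB : ∀ i k, B ⟨i, k⟩ = E'.symm (Pi.single (σ i : ι) (b (σ i) k)) := by
    intro i k
    simp only [B, Module.Basis.reindex_apply, Module.Basis.map_apply]
    congr 1
    exact Pi.basis_apply b _
  have hA : ∀ i k, A *ᵥ (B ⟨i, k⟩) = ∑ l, jordanBlock (e (σ i)) (z (σ i)) l k • B ⟨i, l⟩ := by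
    intro i k
    apply E'.injective
    rw [hE', map_sum]
    simp only [hB, map_smul, LinearEquiv.apply_symm_apply]
    rw [← Pi.single_smul, X_smul_mk _ _ _ (hz _) (b (σ i)) (hb _)]
    funext j
    by_cases hj : j = σ i
    · subst hj
      simp
    · simp [hj]
  refine ⟨Fintype.card ι', fun i => e (σ i), fun i => z (σ i),
    (Pi.basisFun ℂ (Fin n)).toMatrix B, B.toMatrix (Pi.basisFun ℂ (Fin n)),
    fun i => (σ i).2, ?_, ?_, ?_⟩
  · exact Module.Basis.toMatrix_mul_toMatrix_flip _ _
  · exact Module.Basis.toMatrix_mul_toMatrix_flip _ _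
  · have hAZ : A * (Pi.basisFun ℂ (Fin n)).toMatrix B = (Pi.basisFun ℂ (Fin n)).toMatrix B *
        Matrix.blockDiagonal' (fun i => jordanBlock (e (σ i)) (z (σ i))) := by
      ext r ⟨i, k⟩
      have := congrFun (hA i k) r
      simp only [Matrix.mulVec, dotProduct, Finset.sum_apply, Pi.smul_apply, smul_eq_mul] at this
      simp only [Matrix.mul_apply, Module.Basis.toMatrix_apply, Pi.basisFun_repr, this]
      rw [Fintype.sum_sigma, Finset.sum_eq_single i]
      · simp [Matrix.blockDiagonal'_apply_eq, mul_comm]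
      · intro j _ hj
        simp [Matrix.blockDiagonal'_apply_ne _ _ _ hj]
      · simp
    rw [← hAZ, Matrix.mul_assoc, Module.Basis.toMatrix_mul_toMatrix_flip, Matrix.mul_one]

/-! ### Primary roots and generalized eigenspaces -/

theorem mem_spectrum_iff_exists_mulVec {n : ℕ} {A : Matrix (Fin n) (Fin n) ℂ} {z : ℂ} :
    z ∈ spectrum ℂ A ↔ ∃ v, v ≠ 0 ∧ A *ᵥ v = z • v := by
  rw [spectrum.mem_iff, Matrix.isUnit_iff_isUnit_det, isUnit_iff_ne_zero, not_not,
    ← Matrix.exists_mulVec_eq_zero_iff]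
  refine exists_congr fun v => and_congr_right fun _ => ?_
  rw [Matrix.sub_mulVec, sub_eq_zero, Algebra.algebraMap_eq_smul_one, Matrix.smul_mulVec,
    Matrix.one_mulVec, eq_comm]

theorem pow_mulVec_of_mulVec_eq_smul {R : Type*} [CommRing R] {n : ℕ}
    {A : Matrix (Fin n) (Fin n) R} {z : R} {v : Fin n → R} (h : A *ᵥ v = z • v) (k : ℕ) :
    (A ^ k) *ᵥ v = z ^ k • v := by
  induction k with
  | zero => simp
  | succ k ih =>
    rw [pow_succ, ← Matrix.mulVec_mulVec, h, Matrix.mulVec_smul, ih, smul_smul, pow_succ']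

theorem blockDiagonal'_mulVec_apply {t : ℕ} {m : Fin t → ℕ}
    (M : ∀ i, Matrix (Fin (m i)) (Fin (m i)) ℂ) (u : (Σ i, Fin (m i)) → ℂ) (i : Fin t)
    (a : Fin (m i)) :
    (Matrix.blockDiagonal' M *ᵥ u) ⟨i, a⟩ = (M i *ᵥ fun b => u ⟨i, b⟩) a := by
  simp only [Matrix.mulVec, dotProduct]
  rw [Fintype.sum_sigma, Finset.sum_eq_single i]
  · simp [Matrix.blockDiagonal'_apply_eq]
  · intro j _ hj
    simp [Matrix.blockDiagonal'_apply_ne _ _ _ hj.symm]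
  · simp

theorem conj_pow {n : ℕ} {S : Type*} [Fintype S] [DecidableEq S] {Z : Matrix (Fin n) S ℂ}
    {Zinv : Matrix S (Fin n) ℂ} (h₁ : Z * Zinv = 1) (h₂ : Zinv * Z = 1) (D : Matrix S S ℂ) (k : ℕ) :
    (Z * D * Zinv) ^ k = Z * D ^ k * Zinv := by
  induction k with
  | zero => simp [h₁]
  | succ k ih =>
    rw [pow_succ, ih, pow_succ]
    calc Z * D ^ k * Zinv * (Z * D * Zinv) = Z * D ^ k * (Zinv * Z) * D * Zinv := by
          simp only [Matrix.mul_assoc]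
      _ = _ := by rw [h₂, Matrix.mul_one, Matrix.mul_assoc Z]

theorem jordanBlock_sub_det {m : ℕ} (z y : ℂ) :
    (jordanBlock m z - y • (1 : Matrix (Fin m) (Fin m) ℂ)).det = (z - y) ^ m := by
  rw [Matrix.det_of_isUpperTriangular]
  · simp [jordanBlock]
  · intro a b hab
    have hab' : (b : ℕ) < a := hab
    have h1 : a ≠ b := fun h => by simp [h] at hab'
    have h2 : ¬ (a : ℕ) + 1 = b := by omega
    simp [jordanBlock, h1, h2]

theorem toeplitz_X_pow_eq_zero {m n : ℕ} (h : m ≤ n) : toeplitz m (PowerSeries.X ^ n) = 0 := by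
  ext a b
  have := b.2
  have h' : ¬ ((b : ℕ) - a = n) := by omega
  simp [toeplitz, PowerSeries.coeff_X_pow, h']

/-- A Jordan canonical form `A = Z (⊕ J_{m i} (ev i)) Z⁻¹` of a complex matrix. -/
structure JordanForm {n : ℕ} (A : Matrix (Fin n) (Fin n) ℂ) where
  t : ℕ
  m : Fin t → ℕ
  ev : Fin t → ℂ
  Z : Matrix (Fin n) (Σ i, Fin (m i)) ℂ
  Zinv : Matrix (Σ i, Fin (m i)) (Fin n) ℂ
  m_pos : ∀ i, 0 < m i
  mul_inv : Z * Zinv = 1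
  inv_mul : Zinv * Z = 1
  eq : A = Z * Matrix.blockDiagonal' (fun i => jordanBlock (m i) (ev i)) * Zinv

namespace JordanForm

variable {n : ℕ} {A : Matrix (Fin n) (Fin n) ℂ} (F : JordanForm A)

theorem m_le (i : Fin F.t) : F.m i ≤ n := by
  have h1 : Fintype.card (Σ i, Fin (F.m i)) = n := by
    have := (Matrix.toLin'OfInv F.mul_inv F.inv_mul).finrank_eq
    simpa using this.symm
  refine le_of_le_of_eq ?_ h1
  simpa using Fintype.card_le_of_injective (fun a : Fin (F.m i) => (⟨i, a⟩ : Σ i, Fin (F.m i)))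
    (fun a b h => by simpa using h)

theorem sub_smul_pow (z : ℂ) (k : ℕ) :
    (A - z • (1 : Matrix (Fin n) (Fin n) ℂ)) ^ k =
      F.Z * Matrix.blockDiagonal' (fun i => (jordanBlock (F.m i) (F.ev i) - z • 1) ^ k) *
        F.Zinv := by
  have h : A - z • (1 : Matrix (Fin n) (Fin n) ℂ) =
      F.Z * Matrix.blockDiagonal' (fun i => jordanBlock (F.m i) (F.ev i) - z • 1) * F.Zinv := by
    have h1 : Matrix.blockDiagonal' (fun i => jordanBlock (F.m i) (F.ev i) - z • 1) =
        Matrix.blockDiagonal' (fun i => jordanBlock (F.m i) (F.ev i)) - z • 1 := by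
      rw [← Matrix.blockDiagonal'_one, ← Matrix.blockDiagonal'_smul, ← Matrix.blockDiagonal'_sub]
      rfl
    rw [h1, Matrix.mul_sub, Matrix.sub_mul, ← F.eq, Matrix.mul_smul, Matrix.mul_one,
      Matrix.smul_mul, F.mul_inv]
  rw [h, conj_pow F.mul_inv F.inv_mul, ← Matrix.blockDiagonal'_pow]
  rfl

theorem ev_mem_spectrum (i : Fin F.t) : F.ev i ∈ spectrum ℂ A := by
  rw [mem_spectrum_iff_exists_mulVec]
  let u : (Σ i, Fin (F.m i)) → ℂ := Pi.single ⟨i, ⟨0, F.m_pos i⟩⟩ 1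
  have hZ : F.Zinv *ᵥ (F.Z *ᵥ u) = u := by
    rw [Matrix.mulVec_mulVec, F.inv_mul, Matrix.one_mulVec]
  have hD : Matrix.blockDiagonal' (fun i => jordanBlock (F.m i) (F.ev i)) *ᵥ u =
      F.ev i • u := by
    ext ⟨j, a⟩
    simp only [u, Matrix.mulVec_single_one, Matrix.col_apply, Pi.smul_apply, smul_eq_mul]
    by_cases hj : j = i
    · subst hj
      rw [Matrix.blockDiagonal'_apply_eq]
      by_cases ha : a = ⟨0, F.m_pos j⟩
      · subst ha
        simp [jordanBlock]
      · simp [jordanBlock, ha]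
    · rw [Matrix.blockDiagonal'_apply_ne _ _ _ hj, Pi.single_eq_of_ne, mul_zero]
      intro h
      exact hj (congrArg Sigma.fst h)
  refine ⟨F.Z *ᵥ u, ?_, ?_⟩
  · intro h
    rw [h, Matrix.mulVec_zero] at hZ
    have := congrFun hZ ⟨i, ⟨0, F.m_pos i⟩⟩
    simp [u] at this
  · refine (congrArg (· *ᵥ (F.Z *ᵥ u)) F.eq).trans ?_
    rw [← Matrix.mulVec_mulVec, hZ, ← Matrix.mulVec_mulVec, hD, Matrix.mulVec_smul]

/-- The matrix function with Taylor series `s (ev i)` at the eigenvalues, through a Jordan form. -/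
def eval (s : ℂ → PowerSeries ℂ) : Matrix (Fin n) (Fin n) ℂ :=
  F.Z * Matrix.blockDiagonal' (fun i => toeplitz (F.m i) (s (F.ev i))) * F.Zinv

/-- On the generalized eigenspace of `z`, a matrix function is the Taylor polynomial of its series
at `z`. This description does not refer to the Jordan form. -/
theorem eval_mulVec (s : ℂ → PowerSeries ℂ) (z : ℂ) (v : Fin n → ℂ)
    (hv : ((A - z • (1 : Matrix (Fin n) (Fin n) ℂ)) ^ n) *ᵥ v = 0) :
    F.eval s *ᵥ v = (∑ k ∈ Finset.range n, PowerSeries.coeff k (s z) •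
      (A - z • (1 : Matrix (Fin n) (Fin n) ℂ)) ^ k) *ᵥ v := by
  have h1 : (Matrix.blockDiagonal' fun i => (jordanBlock (F.m i) (F.ev i) - z • 1) ^ n) *ᵥ
      (F.Zinv *ᵥ v) = 0 := by
    rw [F.sub_smul_pow, ← Matrix.mulVec_mulVec, ← Matrix.mulVec_mulVec] at hv
    have := congrArg (fun y => F.Zinv *ᵥ y) hv
    simpa only [Matrix.mulVec_mulVec _ F.Zinv F.Z, F.inv_mul, Matrix.one_mulVec,
      Matrix.mulVec_zero] using this
  have h2 : ∀ k, ((A - z • (1 : Matrix (Fin n) (Fin n) ℂ)) ^ k) *ᵥ v =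
      F.Z *ᵥ ((Matrix.blockDiagonal' fun i => (jordanBlock (F.m i) (F.ev i) - z • 1) ^ k) *ᵥ
      (F.Zinv *ᵥ v)) := by
    intro k
    rw [F.sub_smul_pow, Matrix.mulVec_mulVec, Matrix.mulVec_mulVec]
  rw [eval, ← Matrix.mulVec_mulVec, ← Matrix.mulVec_mulVec, Matrix.sum_mulVec]
  simp only [Matrix.smul_mulVec, h2, ← Matrix.mulVec_smul F.Z]
  rw [← Matrix.mulVec_sum]
  congr 1
  ext ⟨i, a⟩
  set u := F.Zinv *ᵥ v
  simp only [Finset.sum_apply, Pi.smul_apply, blockDiagonal'_mulVec_apply]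
  by_cases hi : F.ev i = z
  · rw [← sum_smul_jordanBlock_pow (F.m_le i) (F.ev i), hi, Matrix.sum_mulVec, Finset.sum_apply]
    simp only [Matrix.smul_mulVec, Pi.smul_apply]
  · have h3 : (fun b => u ⟨i, b⟩) = 0 := by
      refine Matrix.eq_zero_of_mulVec_eq_zero
        (M := (jordanBlock (F.m i) (F.ev i) - z • 1) ^ n) ?_ ?_
      · rw [Matrix.det_pow, jordanBlock_sub_det]
        exact pow_ne_zero _ (pow_ne_zero _ (sub_ne_zero.2 hi))
      · ext b
        exact (blockDiagonal'_mulVec_apply _ u i b).symm.trans (congrFun h1 ⟨i, b⟩)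
    simp [h3]

theorem eval_pow (s : ℂ → PowerSeries ℂ) (p : ℕ)
    (h : ∀ i, s (F.ev i) ^ p = PowerSeries.C (F.ev i) + PowerSeries.X) : F.eval s ^ p = A := by
  rw [eval, conj_pow F.mul_inv F.inv_mul, ← Matrix.blockDiagonal'_pow]
  refine Eq.trans ?_ F.eq.symm
  congr 3
  funext i
  rw [Pi.pow_apply, ← toeplitz_pow, h, toeplitz_C_add_X]

include F in
/-- The generalized eigenvectors span, so a matrix is determined by its action on them. -/
theorem ext_of_mulVec {X Y : Matrix (Fin n) (Fin n) ℂ}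
    (h : ∀ (z : ℂ) (v : Fin n → ℂ), ((A - z • (1 : Matrix (Fin n) (Fin n) ℂ)) ^ n) *ᵥ v = 0 →
      X *ᵥ v = Y *ᵥ v) :
    X = Y := by
  have hXY : X * F.Z = Y * F.Z := by
    ext r ⟨i, a⟩
    have hv := h (F.ev i) (F.Z *ᵥ Pi.single ⟨i, a⟩ 1) (by
      rw [F.sub_smul_pow, ← Matrix.mulVec_mulVec, Matrix.mulVec_mulVec _ F.Zinv, F.inv_mul,
        Matrix.one_mulVec, ← Matrix.mulVec_mulVec]
      refine (congrArg (F.Z *ᵥ ·) ?_).trans (Matrix.mulVec_zero F.Z)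
      ext ⟨j, b⟩
      rw [blockDiagonal'_mulVec_apply]
      by_cases hj : j = i
      · subst hj
        rw [← toeplitz_X, ← toeplitz_pow, toeplitz_X_pow_eq_zero (F.m_le j), Matrix.zero_mulVec]
        rfl
      · have : (fun b => (Pi.single ⟨i, a⟩ 1 : (Σ i, Fin (F.m i)) → ℂ) ⟨j, b⟩) = 0 := by
          ext b
          rw [Pi.single_eq_of_ne]
          · rfl
          · exact fun h => hj (congrArg Sigma.fst h)
        rw [this, Matrix.mulVec_zero]
        rfl)
    rw [Matrix.mulVec_mulVec, Matrix.mulVec_mulVec] at hv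
    simpa using congrFun hv r
  calc X = X * F.Z * F.Zinv := by rw [Matrix.mul_assoc, F.mul_inv, Matrix.mul_one]
    _ = Y * F.Z * F.Zinv := by rw [hXY]
    _ = Y := by rw [Matrix.mul_assoc, F.mul_inv, Matrix.mul_one]

end JordanForm

theorem nonempty_jordanForm {n : ℕ} (A : Matrix (Fin n) (Fin n) ℂ) : Nonempty (JordanForm A) := by
  obtain ⟨t, m, ev, Z, Zinv, h₁, h₂, h₃, h₄⟩ := exists_jordan_form A
  exact ⟨⟨t, m, ev, Z, Zinv, h₁, h₂, h₃, h₄⟩⟩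

/-- The Taylor polynomial at `z`, of degree less than `n`, of the branch of the `p`-th root with
value `w` at `z`, evaluated at an `n × n` matrix. -/
def taylorRoot {n : ℕ} (p : ℕ) (z w : ℂ) (A : Matrix (Fin n) (Fin n) ℂ) :
    Matrix (Fin n) (Fin n) ℂ :=
  ∑ k ∈ Finset.range n, PowerSeries.coeff k (rootSeries p z w) •
    (A - z • (1 : Matrix (Fin n) (Fin n) ℂ)) ^ k

/-- `X` acts on the generalized eigenspace of `A` at every `z` as the branch of the `p`-th root
with value `μ z` at `z`. The values of `μ` outside the spectrum of `A` do not matter. -/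
def IsBranchRoot {n : ℕ} (p : ℕ) (A : Matrix (Fin n) (Fin n) ℂ) (μ : ℂ → ℂ)
    (X : Matrix (Fin n) (Fin n) ℂ) : Prop :=
  ∀ (z : ℂ) (v : Fin n → ℂ), ((A - z • (1 : Matrix (Fin n) (Fin n) ℂ)) ^ n) *ᵥ v = 0 →
    X *ᵥ v = taylorRoot p z (μ z) A *ᵥ v

namespace IsBranchRoot

variable {n p : ℕ} {A X Y : Matrix (Fin n) (Fin n) ℂ} {μ ν : ℂ → ℂ}

theorem unique (hX : IsBranchRoot p A μ X) (hY : IsBranchRoot p A μ Y) : X = Y := by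
  obtain ⟨F⟩ := nonempty_jordanForm A
  exact F.ext_of_mulVec fun z v hv => (hX z v hv).trans (hY z v hv).symm

theorem mulVec_eq (hX : IsBranchRoot p A μ X) {z : ℂ} {v : Fin n → ℂ} (hv : A *ᵥ v = z • v) :
    X *ᵥ v = μ z • v := by
  rcases n.eq_zero_or_pos with rfl | hn
  · exact Subsingleton.elim _ _
  have h0 : (A - z • (1 : Matrix (Fin n) (Fin n) ℂ)) *ᵥ v = (0 : ℂ) • v := by
    rw [Matrix.sub_mulVec, hv, Matrix.smul_mulVec, Matrix.one_mulVec, sub_self, zero_smul]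
  have hk := pow_mulVec_of_mulVec_eq_smul h0
  rw [hX z v (by rw [hk, zero_pow hn.ne', zero_smul]), taylorRoot, Matrix.sum_mulVec,
    Finset.sum_eq_single 0]
  · simp [coeff_rootSeries, Matrix.smul_mulVec]
  · intro k _ hk0
    rw [Matrix.smul_mulVec, hk, zero_pow hk0, zero_smul, smul_zero]
  · intro h
    exact absurd (Finset.mem_range.2 hn) h

theorem eqOn (hX : IsBranchRoot p A μ X) (hX' : IsBranchRoot p A ν X) :
    Set.EqOn μ ν (spectrum ℂ A) := by
  intro z hz
  obtain ⟨v, hv0, hv⟩ := mem_spectrum_iff_exists_mulVec.1 hz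
  have h := (hX.mulVec_eq hv).symm.trans (hX'.mulVec_eq hv)
  exact smul_left_injective ℂ hv0 h

theorem congr (hX : IsBranchRoot p A μ X) (h : Set.EqOn μ ν (spectrum ℂ A)) :
    IsBranchRoot p A ν X := by
  intro z v hv
  by_cases hz : z ∈ spectrum ℂ A
  · rw [hX z v hv, h hz]
  · have h1 : v = 0 := by
      refine Matrix.eq_zero_of_mulVec_eq_zero ?_ hv
      rw [Matrix.det_pow]
      refine pow_ne_zero _ ?_
      rw [spectrum.notMem_iff, IsUnit.sub_iff, Matrix.isUnit_iff_isUnit_det, isUnit_iff_ne_zero,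
        Algebra.algebraMap_eq_smul_one] at hz
      exact hz
    rw [h1, Matrix.mulVec_zero, Matrix.mulVec_zero]

end IsBranchRoot

/-- The primary roots are the matrices that act as a branch of the root on each generalized
eigenspace. -/
theorem isPrimaryRoot_iff {n p : ℕ} (hp : p ≠ 0) {A X : Matrix (Fin n) (Fin n) ℂ}
    (hA : A.det ≠ 0) :
    IsPrimaryRoot p A X ↔
      ∃ μ : ℂ → ℂ, (∀ z ∈ spectrum ℂ A, μ z ^ p = z) ∧ IsBranchRoot p A μ X := by
  classical
  have h0 : ∀ z ∈ spectrum ℂ A, z ≠ 0 := by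
    rintro z hz rfl
    rw [spectrum.zero_mem_iff, Matrix.isUnit_iff_isUnit_det, isUnit_iff_ne_zero] at hz
    exact hz hA
  constructor
  · rintro ⟨-, t, m, ev, Z, Zinv, j, hm, h₁, h₂, hAZ, -, hj, hXZ⟩
    let F : JordanForm A := ⟨t, m, ev, Z, Zinv, hm, h₁, h₂, hAZ⟩
    let μ : ℂ → ℂ := fun z => rootBranch p (if h : ∃ i, ev i = z then j h.choose else 0) z
    have hμ : ∀ i, μ (ev i) = rootBranch p (j i) (ev i) := by
      intro i
      have h : ∃ k, ev k = ev i := ⟨i, rfl⟩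
      simp only [μ, dif_pos h]
      rw [hj _ _ h.choose_spec]
    refine ⟨μ, fun z _ => rootBranch_pow hp _ z, ?_⟩
    have hX : X = F.eval fun z => rootSeries p z (μ z) := by
      rw [hXZ, JordanForm.eval]
      congr 3
      funext i
      have hi : ev i ≠ 0 := h0 _ (F.ev_mem_spectrum i)
      change _ = toeplitz (m i) (rootSeries p (ev i) (μ (ev i)))
      rw [hμ, rootJordanBlock_eq_toeplitz hp _ _ hi]
    rw [hX]
    exact fun z v hv => F.eval_mulVec _ z v hv
  · rintro ⟨μ, hμ, hX⟩
    obtain ⟨F⟩ := nonempty_jordanForm A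
    have hXF : X = F.eval fun z => rootSeries p z (μ z) :=
      hX.unique fun z v hv => F.eval_mulVec _ z v hv
    have hex : ∀ z, ∃ j < p, z ∈ spectrum ℂ A → rootBranch p j z = μ z := by
      intro z
      by_cases hz : z ∈ spectrum ℂ A
      · obtain ⟨j, hj, h⟩ := exists_rootBranch_eq hp (h0 z hz) (hμ z hz)
        exact ⟨j, hj, fun _ => h⟩
      · exact ⟨0, Nat.pos_of_ne_zero hp, fun h => absurd h hz⟩
    choose j hj hjμ using hex
    refine ⟨?_, F.t, F.m, F.ev, F.Z, F.Zinv, fun i => j (F.ev i), F.m_pos, F.mul_inv, F.inv_mul,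
      F.eq, fun i => hj _, fun i k h => congrArg j h, ?_⟩
    · rw [hXF]
      exact F.eval_pow _ _ fun i => rootSeries_pow hp (h0 _ (F.ev_mem_spectrum i))
        (hμ _ (F.ev_mem_spectrum i))
    · rw [hXF, JordanForm.eval]
      congr 3
      funext i
      rw [rootJordanBlock_eq_toeplitz hp _ _ (h0 _ (F.ev_mem_spectrum i)),
        hjμ _ (F.ev_mem_spectrum i)]

theorem exists_isBranchRoot {n : ℕ} (p : ℕ) (A : Matrix (Fin n) (Fin n) ℂ) (μ : ℂ → ℂ) :
    ∃ X, IsBranchRoot p A μ X := by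
  obtain ⟨F⟩ := nonempty_jordanForm A
  exact ⟨F.eval fun z => rootSeries p z (μ z), fun z v hv => F.eval_mulVec _ z v hv⟩

theorem map_conj_toComplex {n : ℕ} (A : Matrix (Fin n) (Fin n) ℝ) :
    (toComplex A).map conj = toComplex A := by
  ext i j
  simp [toComplex]

theorem exists_toComplex_eq {n : ℕ} {X : Matrix (Fin n) (Fin n) ℂ} (h : X.map conj = X) :
    ∃ Y, toComplex Y = X := by
  refine ⟨X.map Complex.re, ?_⟩
  ext i j
  have : conj (X i j) = X i j := congrFun (congrFun h i) j
  exact Complex.conj_eq_iff_re.1 this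

theorem map_conj_mulVec {n : ℕ} (X : Matrix (Fin n) (Fin n) ℂ) (v : Fin n → ℂ) :
    X.map conj *ᵥ (conj ∘ v) = conj ∘ (X *ᵥ v) := by
  ext i
  simp [Matrix.mulVec, dotProduct]

theorem map_conj_taylorRoot {n : ℕ} (p : ℕ) (z w : ℂ) (A : Matrix (Fin n) (Fin n) ℝ) :
    (taylorRoot p z w (toComplex A)).map conj =
      taylorRoot p (conj z) (conj w) (toComplex A) := by
  let Φ : Matrix (Fin n) (Fin n) ℂ →+* Matrix (Fin n) (Fin n) ℂ := (starRingEnd ℂ).mapMatrix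
  have hsmul : ∀ (c : ℂ) (B : Matrix (Fin n) (Fin n) ℂ), Φ (c • B) = conj c • Φ B := by
    intro c B
    ext i j
    simp [Φ]
  have hA : Φ (toComplex A) = toComplex A := map_conj_toComplex A
  change Φ _ = _
  simp only [taylorRoot, map_sum, hsmul, map_pow, map_sub, hA, map_one, conj_coeff_rootSeries]

/-- Complex conjugation turns a branch root of a real matrix into the branch root for the
conjugated choice of branches. -/
theorem IsBranchRoot.map_conj {n p : ℕ} {A : Matrix (Fin n) (Fin n) ℝ} {μ : ℂ → ℂ}
    {X : Matrix (Fin n) (Fin n) ℂ} (hX : IsBranchRoot p (toComplex A) μ X) :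
    IsBranchRoot p (toComplex A) (fun z => conj (μ (conj z))) (X.map conj) := by
  have hcc : ∀ v : Fin n → ℂ, conj ∘ (conj ∘ v) = v := fun v => by ext; simp
  intro z v hv
  have hconj : (((toComplex A - z • (1 : Matrix (Fin n) (Fin n) ℂ)) ^ n).map conj) =
      (toComplex A - conj z • (1 : Matrix (Fin n) (Fin n) ℂ)) ^ n := by
    let Φ : Matrix (Fin n) (Fin n) ℂ →+* Matrix (Fin n) (Fin n) ℂ := (starRingEnd ℂ).mapMatrix
    have hA : Φ (toComplex A) = toComplex A := map_conj_toComplex A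
    have hz : Φ (z • 1) = conj z • 1 := by
      ext i j
      simp only [Φ, RingHom.mapMatrix_apply, Matrix.map_apply, Matrix.smul_apply,
        Matrix.one_apply, smul_eq_mul]
      split_ifs <;> simp
    change Φ _ = _
    rw [map_pow, map_sub, hA, hz]
  have h1 := hX (conj z) (conj ∘ v) (by
    rw [← hconj, map_conj_mulVec, hv]
    ext
    simp)
  have h2 := congrArg (conj ∘ ·) h1
  simp only [← map_conj_mulVec, hcc, map_conj_taylorRoot, Complex.conj_conj] at h2
  exact h2

theorem map_conj_eq_iff {n p : ℕ} {A : Matrix (Fin n) (Fin n) ℝ} {μ : ℂ → ℂ}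
    {X : Matrix (Fin n) (Fin n) ℂ} (hX : IsBranchRoot p (toComplex A) μ X) :
    X.map conj = X ↔ ∀ z ∈ spectrum ℂ (toComplex A), μ (conj z) = conj (μ z) := by
  constructor
  · intro h z hz
    have h1 := hX.map_conj
    rw [h] at h1
    have h2 := h1.eqOn hX hz
    simp only at h2
    rw [← h2, Complex.conj_conj]
  · intro h
    refine hX.map_conj.unique (hX.congr fun z hz => ?_)
    rw [h z hz, Complex.conj_conj]

/-! ### The Perron–Frobenius theorem -/

theorem toComplex_pow {n : ℕ} (A : Matrix (Fin n) (Fin n) ℝ) (k : ℕ) :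
    toComplex (A ^ k) = toComplex A ^ k :=
  map_pow (Complex.ofRealHom.mapMatrix : Matrix (Fin n) (Fin n) ℝ →+* _) A k

theorem toComplex_mulVec {n : ℕ} (A : Matrix (Fin n) (Fin n) ℝ) (v : Fin n → ℝ) :
    toComplex A *ᵥ (fun i => (v i : ℂ)) = fun i => ((A *ᵥ v) i : ℂ) := by
  ext i
  simp [toComplex, Matrix.mulVec, dotProduct]

theorem det_toComplex {n : ℕ} (A : Matrix (Fin n) (Fin n) ℝ) :
    (toComplex A).det = (A.det : ℂ) :=
  (Complex.ofRealHom.map_det A).symm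

theorem ofReal_mem_spectrum_of_mulVec {n : ℕ} {A : Matrix (Fin n) (Fin n) ℝ} {r : ℝ}
    {v : Fin n → ℝ} (hv0 : v ≠ 0) (hv : A *ᵥ v = r • v) :
    (r : ℂ) ∈ spectrum ℂ (toComplex A) := by
  rw [mem_spectrum_iff_exists_mulVec]
  refine ⟨fun i => (v i : ℂ), ?_, ?_⟩
  · intro h
    exact hv0 (funext fun i => by simpa using congrFun h i)
  · rw [toComplex_mulVec, hv]
    ext i
    simp

section Gelfand

attribute [local instance] Matrix.linftyOpNormedRing Matrix.linftyOpNormedAlgebra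

/-- The powers of a matrix are of smaller order than `s ^ k` if `s` exceeds the spectral radius. -/
theorem tendsto_pow_div_pow {n : ℕ} (M : Matrix (Fin n) (Fin n) ℂ) {s : ℝ} (hs : 0 < s)
    (h : ∀ z ∈ spectrum ℂ M, ‖z‖ < s) (i j : Fin n) :
    Tendsto (fun k : ℕ => (M ^ k) i j / (s : ℂ) ^ k) atTop (𝓝 0) := by
  have : Nonempty (Fin n) := ⟨i⟩
  have : CompleteSpace (Matrix (Fin n) (Fin n) ℂ) := FiniteDimensional.complete ℂ _
  have hrad : spectralRadius ℂ M < ENNReal.ofReal s := by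
    refine spectrum.spectralRadius_lt_of_forall_lt_of_nonempty (r := s.toNNReal)
      (spectrum.nonempty M) fun z hz => ?_
    rw [← NNReal.coe_lt_coe, Real.coe_toNNReal _ hs.le]
    exact h z hz
  obtain ⟨q, hq1, hq2⟩ := exists_between hrad
  have hqtop : q ≠ ⊤ := (hq2.trans_le le_top).ne
  have hqs : q.toReal < s := by
    rw [← ENNReal.toReal_ofReal hs.le]
    exact (ENNReal.toReal_lt_toReal hqtop ENNReal.ofReal_ne_top).2 hq2
  have hev : ∀ᶠ k : ℕ in atTop, ‖M ^ k‖ ≤ q.toReal ^ k := by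
    have hG := spectrum.pow_norm_pow_one_div_tendsto_nhds_spectralRadius M
    filter_upwards [hG.eventually_lt_const hq1, eventually_gt_atTop 0] with k hk hk0
    have h1 : ‖M ^ k‖ ^ (1 / k : ℝ) ≤ q.toReal := by
      rw [← ENNReal.ofReal_le_iff_le_toReal hqtop]
      exact hk.le
    have h2 := pow_le_pow_left₀ (by positivity) h1 k
    rwa [← Real.rpow_natCast, ← Real.rpow_mul (norm_nonneg _),
      one_div_mul_cancel (by exact_mod_cast hk0.ne'), Real.rpow_one] at h2
  have hlim : Tendsto (fun k : ℕ => ((s : ℂ) ^ k)⁻¹ • M ^ k) atTop (𝓝 0) := by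
    refine squeeze_zero_norm' (a := fun k : ℕ => (q.toReal / s) ^ k) ?_
      (tendsto_pow_atTop_nhds_zero_of_lt_one (by positivity) (by rwa [div_lt_one hs]))
    filter_upwards [hev] with k hk
    rw [norm_smul, norm_inv, norm_pow, Complex.norm_real, Real.norm_of_nonneg hs.le, div_pow,
      inv_mul_eq_div]
    gcongr
  let L : Matrix (Fin n) (Fin n) ℂ →ₗ[ℂ] ℂ := Matrix.entryLinearMap ℂ ℂ i j
  have hL := (L.continuous_of_finiteDimensional.tendsto 0).comp hlim
  rw [map_zero] at hL
  refine hL.congr fun k => ?_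
  simp [L, div_eq_inv_mul]

end Gelfand

theorem tendsto_pow_div_pow_real {n : ℕ} (M : Matrix (Fin n) (Fin n) ℝ) {s : ℝ} (hs : 0 < s)
    (h : ∀ z ∈ spectrum ℂ (toComplex M), ‖z‖ < s) (i j : Fin n) :
    Tendsto (fun k : ℕ => (M ^ k) i j / s ^ k) atTop (𝓝 0) := by
  have h1 := (Complex.continuous_re.tendsto 0).comp (tendsto_pow_div_pow (toComplex M) hs h i j)
  rw [Complex.zero_re] at h1
  refine h1.congr fun k => ?_
  have h2 : (toComplex M ^ k) i j = (((M ^ k) i j : ℝ) : ℂ) := by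
    rw [← toComplex_pow]
    rfl
  simp only [Function.comp_apply]
  rw [h2, ← Complex.ofReal_pow, ← Complex.ofReal_div, Complex.ofReal_re]

/-- Strong connectivity of the digraph of a matrix, with an arc from `j` to `i` for each nonzero
entry `A i j`: every nonempty proper set of indices has an arc that leaves it. -/
def StronglyConnected {n : ℕ} (A : Matrix (Fin n) (Fin n) ℝ) : Prop :=
  ∀ S : Set (Fin n), S.Nonempty → Sᶜ.Nonempty → ∃ i ∉ S, ∃ j ∈ S, A i j ≠ 0

theorem stronglyConnected_of_not_reducible {n : ℕ} {A : Matrix (Fin n) (Fin n) ℝ}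
    (h : ¬ Reducible A) : StronglyConnected A := by
  classical
  intro S hS hSc
  by_contra! hA
  have : Nonempty S := hS.to_subtype
  have : Nonempty (Sᶜ : Set (Fin n)) := hSc.to_subtype
  refine h ⟨Fintype.card S, Fintype.card (Sᶜ : Set (Fin n)),
    ((Fintype.equivFin S).symm.sumCongr (Fintype.equivFin (Sᶜ : Set (Fin n))).symm).trans
      (Equiv.Set.sumCompl S), Fintype.card_pos, Fintype.card_pos, ?_⟩
  ext a b
  simp only [Matrix.toBlocks₂₁, Matrix.of_apply, Matrix.submatrix_apply, Equiv.trans_apply,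
    Equiv.sumCongr_apply, Sum.map_inl, Sum.map_inr, Equiv.Set.sumCompl_apply_inl,
    Equiv.Set.sumCompl_apply_inr, Matrix.zero_apply]
  exact hA _ ((Fintype.equivFin (Sᶜ : Set (Fin n))).symm a).2 _ ((Fintype.equivFin S).symm b).2

theorem StronglyConnected.transpose {n : ℕ} {A : Matrix (Fin n) (Fin n) ℝ}
    (h : StronglyConnected A) : StronglyConnected Aᵀ := by
  intro S hS hSc
  obtain ⟨i, hi, j, hj, hij⟩ := h Sᶜ hSc (by rwa [compl_compl])
  exact ⟨j, hj, i, not_not.1 hi, hij⟩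

section Perron

variable {n : ℕ} {A : Matrix (Fin n) (Fin n) ℝ}

theorem mulVec_nonneg (hA : ∀ i j, 0 ≤ A i j) {y : Fin n → ℝ} (hy : ∀ i, 0 ≤ y i) (i : Fin n) :
    0 ≤ (A *ᵥ y) i := by
  rw [Matrix.mulVec, dotProduct]
  exact Finset.sum_nonneg fun j _ => mul_nonneg (hA i j) (hy j)

theorem one_add_pow_mulVec_nonneg (hA : ∀ i j, 0 ≤ A i j) {y : Fin n → ℝ} (hy : ∀ i, 0 ≤ y i)
    (k : ℕ) (i : Fin n) : 0 ≤ (((1 + A) ^ k) *ᵥ y) i := by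
  induction k generalizing i with
  | zero => simpa using hy i
  | succ k ih =>
    rw [pow_succ', ← Matrix.mulVec_mulVec, Matrix.add_mulVec, Matrix.one_mulVec, Pi.add_apply]
    exact add_nonneg (ih i) (mulVec_nonneg hA ih i)

/-- Each factor `1 + A` enlarges the support of a nonnegative vector until it is everything. -/
theorem one_add_pow_mulVec_pos (hA : ∀ i j, 0 ≤ A i j) (hirr : StronglyConnected A)
    {y : Fin n → ℝ} (hy : ∀ i, 0 ≤ y i) (hy0 : y ≠ 0) (i : Fin n) :
    0 < (((1 + A) ^ n) *ᵥ y) i := by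
  classical
  let S : ℕ → Finset (Fin n) := fun k => {i | 0 < (((1 + A) ^ k) *ᵥ y) i}
  have hmem : ∀ k i, i ∈ S k ↔ 0 < (((1 + A) ^ k) *ᵥ y) i := by simp [S]
  have hsucc : ∀ k i, (((1 + A) ^ (k + 1)) *ᵥ y) i =
      (((1 + A) ^ k) *ᵥ y) i + (A *ᵥ (((1 + A) ^ k) *ᵥ y)) i := by
    intro k i
    rw [pow_succ', ← Matrix.mulVec_mulVec, Matrix.add_mulVec, Matrix.one_mulVec, Pi.add_apply]
  have hnn := one_add_pow_mulVec_nonneg hA hy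
  have hmono : ∀ k, S k ⊆ S (k + 1) := by
    intro k i hi
    rw [hmem] at hi ⊢
    rw [hsucc]
    exact add_pos_of_pos_of_nonneg hi (mulVec_nonneg hA (hnn k) i)
  -- so the support of `(1 + A) ^ n y`, which cannot have `n + 1` elements, is everything
  have hcard : ∀ k, S k = Finset.univ ∨ k + 1 ≤ (S k).card := by
    intro k
    induction k with
    | zero =>
      right
      obtain ⟨i, hi⟩ := Function.ne_iff.1 hy0
      refine Finset.card_pos.2 ⟨i, (hmem 0 i).2 ?_⟩
      simpa using lt_of_le_of_ne (hy i) (Ne.symm hi)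
    | succ k ih =>
      rcases ih with ih | ih
      · left
        rw [Finset.eq_univ_iff_forall] at ih ⊢
        exact fun i => hmono k (ih i)
      · by_cases hu : S k = Finset.univ
        · left
          rw [Finset.eq_univ_iff_forall] at hu ⊢
          exact fun i => hmono k (hu i)
        · right
          obtain ⟨i, hi, j, hj, hij⟩ := hirr (S k)
            (by
              rw [Finset.coe_nonempty, ← Finset.card_pos]
              omega)
            (by
              rw [Set.nonempty_compl]
              exact fun h => hu (by exact_mod_cast h))
          have hi' : i ∉ S k := hi
          have hj' : j ∈ S k := hj
          have hss : S k ⊂ S (k + 1) := by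
            refine (Finset.ssubset_iff_of_subset (hmono k)).2 ⟨i, ?_, hi'⟩
            rw [hmem, hsucc]
            refine add_pos_of_nonneg_of_pos (hnn k i) ?_
            refine Finset.sum_pos' (fun l _ => mul_nonneg (hA i l) (hnn k l))
              ⟨j, Finset.mem_univ _, ?_⟩
            exact mul_pos (lt_of_le_of_ne (hA i j) (Ne.symm hij)) ((hmem k j).1 hj')
          have := Finset.card_lt_card hss
          omega
  rcases hcard n with h | h
  · exact (hmem n i).1 (h ▸ Finset.mem_univ i)
  · have := Finset.card_le_univ (S n)
    rw [Fintype.card_fin] at this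
    omega

theorem one_add_pow_mulVec_eq {r : ℝ} {y : Fin n → ℝ} (h : A *ᵥ y = r • y) (k : ℕ) :
    ((1 + A) ^ k) *ᵥ y = (1 + r) ^ k • y := by
  refine pow_mulVec_of_mulVec_eq_smul ?_ k
  rw [Matrix.add_mulVec, Matrix.one_mulVec, h, add_smul, one_smul]

theorem pos_of_mulVec_eq_smul (hA : ∀ i j, 0 ≤ A i j) (hirr : StronglyConnected A) {r : ℝ}
    (hr : 0 ≤ r) {y : Fin n → ℝ} (hy : ∀ i, 0 ≤ y i) (hy0 : y ≠ 0) (h : A *ᵥ y = r • y)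
    (i : Fin n) : 0 < y i := by
  have h1 := one_add_pow_mulVec_pos hA hirr hy hy0 i
  rw [one_add_pow_mulVec_eq h, Pi.smul_apply, smul_eq_mul] at h1
  exact (pos_iff_pos_of_mul_pos h1).1 (by positivity)

/-- A nonnegative vector that is subinvariant at the spectral radius is invariant. Otherwise a
positive vector would grow at a rate above the spectral radius. -/
theorem mulVec_eq_of_smul_le (hA : ∀ i j, 0 ≤ A i j) (hirr : StronglyConnected A) {r : ℝ}
    (hr : 0 < r) (hspec : ∀ z ∈ spectrum ℂ (toComplex A), ‖z‖ ≤ r) {y : Fin n → ℝ}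
    (hy : ∀ i, 0 ≤ y i) (hle : ∀ i, r * y i ≤ (A *ᵥ y) i) : A *ᵥ y = r • y := by
  by_contra hne
  have hy0 : y ≠ 0 := by
    rintro rfl
    simp at hne
  obtain ⟨i₀, -⟩ := Function.ne_iff.1 hy0
  have : Nonempty (Fin n) := ⟨i₀⟩
  set B := (1 + A) ^ n with hB
  set w := B *ᵥ y with hw
  have hwpos : ∀ i, 0 < w i := one_add_pow_mulVec_pos hA hirr hy hy0
  have hcomm : A * B = B * A := ((Commute.one_right A).add_right (Commute.refl A)).pow_right n
  have hgap : ∀ i, r * w i < (A *ᵥ w) i := by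
    intro i
    have h1 := one_add_pow_mulVec_pos hA hirr (y := A *ᵥ y - r • y)
      (fun i => by simpa using hle i) (sub_ne_zero.2 hne) i
    rw [Matrix.mulVec_sub, Matrix.mulVec_smul, ← hB, ← hw, Matrix.mulVec_mulVec, ← hcomm,
      ← Matrix.mulVec_mulVec, ← hw] at h1
    simpa using h1
  -- the least growth factor of `w` under `A`, which exceeds `r` strictly
  obtain ⟨i₁, hi₁⟩ := Finite.exists_min fun i => (A *ᵥ w) i / w i
  set s := (A *ᵥ w) i₁ / w i₁ with hs
  have hrs : r < s := by
    rw [hs, lt_div_iff₀ (hwpos i₁)]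
    exact hgap i₁
  have hs0 : 0 < s := hr.trans hrs
  have hgrow : ∀ k i, s ^ k * w i ≤ ((A ^ k) *ᵥ w) i := by
    intro k
    induction k with
    | zero => simp
    | succ k ih =>
      intro i
      rw [pow_succ' A, ← Matrix.mulVec_mulVec]
      calc s ^ (k + 1) * w i = s ^ k * (s * w i) := by ring
        _ ≤ s ^ k * (A *ᵥ w) i := by
          gcongr
          exact (le_div_iff₀ (hwpos i)).1 (hi₁ i)
        _ = ∑ j, A i j * (s ^ k * w j) := by
          simp only [Matrix.mulVec, dotProduct, Finset.mul_sum]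
          exact Finset.sum_congr rfl fun j _ => by ring
        _ ≤ _ := Finset.sum_le_sum fun j _ => mul_le_mul_of_nonneg_left (ih j) (hA i j)
  have hlim : Tendsto (fun k : ℕ => ∑ j, (A ^ k) i₀ j / s ^ k * w j) atTop (𝓝 (∑ j, 0 * w j)) :=
    tendsto_finsetSum _ fun j _ => (tendsto_pow_div_pow_real A hs0
      (fun z hz => (hspec z hz).trans_lt hrs) i₀ j).mul_const (w j)
  simp only [zero_mul, Finset.sum_const_zero] at hlim
  refine (hwpos i₀).not_ge (ge_of_tendsto' hlim fun k => ?_)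
  have h1 : ∑ j, (A ^ k) i₀ j / s ^ k * w j = ((A ^ k) *ᵥ w) i₀ / s ^ k := by
    simp only [Matrix.mulVec, dotProduct, Finset.sum_div]
    exact Finset.sum_congr rfl fun j _ => by ring
  rw [h1, le_div_iff₀ (by positivity), mul_comm]
  exact hgrow k i₀

/-- The vector of moduli of an eigenvector at the spectral radius is an eigenvector. -/
theorem mulVec_norm_eq (hA : ∀ i j, 0 ≤ A i j) (hirr : StronglyConnected A) {r : ℝ}
    (hr : 0 < r) (hspec : ∀ z ∈ spectrum ℂ (toComplex A), ‖z‖ ≤ r) {z : ℂ} (hz : ‖z‖ = r)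
    {x : Fin n → ℂ} (hx : toComplex A *ᵥ x = z • x) :
    A *ᵥ (fun i => ‖x i‖) = r • fun i => ‖x i‖ := by
  refine mulVec_eq_of_smul_le hA hirr hr hspec (fun i => norm_nonneg _) fun i => ?_
  calc r * ‖x i‖ = ‖(toComplex A *ᵥ x) i‖ := by simp [hx, hz]
    _ ≤ ∑ j, ‖toComplex A i j * x j‖ := by
      rw [Matrix.mulVec, dotProduct]
      exact norm_sum_le _ _
    _ = _ := by
      simp only [Matrix.mulVec, dotProduct, norm_mul, toComplex, Matrix.map_apply,
        Complex.norm_real, Real.norm_of_nonneg (hA _ _)]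

theorem exists_pos_eigenvector (hA : ∀ i j, 0 ≤ A i j) (hirr : StronglyConnected A) {r : ℝ}
    (hr : 0 < r) (hspec : ∀ z ∈ spectrum ℂ (toComplex A), ‖z‖ ≤ r)
    (hex : ∃ z ∈ spectrum ℂ (toComplex A), ‖z‖ = r) :
    ∃ v : Fin n → ℝ, (∀ i, 0 < v i) ∧ A *ᵥ v = r • v := by
  obtain ⟨z, hz, hzr⟩ := hex
  obtain ⟨x, hx0, hx⟩ := mem_spectrum_iff_exists_mulVec.1 hz
  have h := mulVec_norm_eq hA hirr hr hspec hzr hx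
  refine ⟨_, pos_of_mulVec_eq_smul hA hirr hr.le (fun i => norm_nonneg _) ?_ h, h⟩
  intro h0
  exact hx0 (funext fun i => by simpa using congrFun h0 i)

/-- The real eigenspace at the spectral radius meets the hyperplane orthogonal to a positive vector
only in zero: an eigenvector there has no sign changes. -/
theorem eq_zero_of_dotProduct_eq_zero (hA : ∀ i j, 0 ≤ A i j) (hirr : StronglyConnected A)
    {r : ℝ} (hr : 0 < r) (hspec : ∀ z ∈ spectrum ℂ (toComplex A), ‖z‖ ≤ r) {w x : Fin n → ℝ}
    (hw : ∀ i, 0 < w i) (hx : A *ᵥ x = r • x) (hwx : w ⬝ᵥ x = 0) : x = 0 := by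
  by_contra hx0
  obtain ⟨i₀, -⟩ := Function.ne_iff.1 hx0
  have habs : A *ᵥ (fun i => |x i|) = r • fun i => |x i| := by
    have h := mulVec_norm_eq hA hirr hr hspec (z := r) (x := fun i => (x i : ℂ))
      (by rw [Complex.norm_real, Real.norm_of_nonneg hr.le])
      (by
        rw [toComplex_mulVec, hx]
        ext i
        simp)
    simpa using h
  have hpos : ∀ i, 0 < |x i| := pos_of_mulVec_eq_smul hA hirr hr.le (fun i => abs_nonneg _)
    (fun h => hx0 (funext fun i => by simpa using congrFun h i)) habs
  by_cases hs : (fun i => |x i|) + x = 0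
  · have hneg : ∀ i, x i < 0 := fun i => by
      have h1 : |x i| + x i = 0 := congrFun hs i
      linarith [hpos i]
    have : w ⬝ᵥ x < 0 := Finset.sum_neg (fun i _ => mul_neg_of_pos_of_neg (hw i) (hneg i))
      ⟨i₀, Finset.mem_univ _⟩
    exact this.ne hwx
  · have h1 := pos_of_mulVec_eq_smul hA hirr hr.le (y := (fun i => |x i|) + x)
      (fun i => by
        have := neg_abs_le (x i)
        simp only [Pi.add_apply]
        linarith) hs
      (by rw [Matrix.mulVec_add, habs, hx, smul_add])
    have hxpos : ∀ i, 0 < x i := by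
      intro i
      have h2 : 0 < |x i| + x i := h1 i
      rcases abs_cases (x i) with h | h <;> linarith [hpos i]
    have : 0 < w ⬝ᵥ x := Finset.sum_pos (fun i _ => mul_pos (hw i) (hxpos i))
      ⟨i₀, Finset.mem_univ _⟩
    exact this.ne' hwx

theorem spectrum_transpose (M : Matrix (Fin n) (Fin n) ℂ) : spectrum ℂ Mᵀ = spectrum ℂ M := by
  ext z
  rw [spectrum.mem_iff, spectrum.mem_iff, Matrix.isUnit_iff_isUnit_det,
    Matrix.isUnit_iff_isUnit_det, ← Matrix.det_transpose, Matrix.transpose_sub,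
    Matrix.transpose_transpose, Algebra.algebraMap_eq_smul_one, Matrix.transpose_smul,
    Matrix.transpose_one]

/-- Away from the Perron root `r`, the spectrum of `A` is inside the disc of radius `r`, so
subtracting `r` times the rank one spectral projection leaves a spectral radius below `r`. -/
theorem norm_lt_of_mem_spectrum_sub (hA : ∀ i j, 0 ≤ A i j) (hirr : StronglyConnected A)
    {r : ℝ} (hr : 0 < r) (hspec : ∀ z ∈ spectrum ℂ (toComplex A), ‖z‖ ≤ r)
    (huniq : ∀ z ∈ spectrum ℂ (toComplex A), ‖z‖ = r → z = r) {v w : Fin n → ℝ}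
    (hw : ∀ i, 0 < w i) (hAw : w ᵥ* A = r • w) (hwv : w ⬝ᵥ v = 1) :
    ∀ z ∈ spectrum ℂ (toComplex (A - r • vecMulVec v w)), ‖z‖ < r := by
  intro z hz
  obtain ⟨x, hx0, hx⟩ := mem_spectrum_iff_exists_mulVec.1 hz
  let w' : Fin n → ℂ := fun i => w i
  let v' : Fin n → ℂ := fun i => v i
  have hw'v' : w' ⬝ᵥ v' = 1 := by
    have := congrArg (Complex.ofReal) hwv
    simpa [dotProduct] using this
  have hw'A : w' ᵥ* toComplex A = (r : ℂ) • w' := by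
    ext i
    have := congrArg (Complex.ofReal) (congrFun hAw i)
    simpa [dotProduct, Matrix.vecMul, toComplex, w'] using this
  have hM : toComplex (A - r • vecMulVec v w) = toComplex A - (r : ℂ) • vecMulVec v' w' := by
    ext i j
    simp [toComplex, vecMulVec, v', w']
  rw [hM, Matrix.sub_mulVec, Matrix.smul_mulVec, Matrix.vecMulVec_mulVec] at hx
  have h0 : z * (w' ⬝ᵥ x) = 0 := by
    have h1 := congrArg (fun u => w' ⬝ᵥ u) hx
    simp only [dotProduct_sub, dotProduct_smul, Matrix.dotProduct_mulVec, hw'A,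
      smul_dotProduct, smul_eq_mul, op_smul_eq_smul, hw'v'] at h1
    rw [← h1]
    ring
  by_cases hz0 : z = 0
  · rwa [hz0, norm_zero]
  -- for `z ≠ 0` the eigenvector is orthogonal to `w`, so it is an eigenvector of `A` itself
  have hwx : w' ⬝ᵥ x = 0 := (mul_eq_zero.1 h0).resolve_left hz0
  rw [hwx] at hx
  simp only [MulOpposite.op_zero, zero_smul, smul_zero, sub_zero] at hx
  have hzA : z ∈ spectrum ℂ (toComplex A) := mem_spectrum_iff_exists_mulVec.2 ⟨x, hx0, hx⟩
  refine lt_of_le_of_ne (hspec z hzA) fun hzr => hx0 ?_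
  rw [huniq z hzA hzr] at hx
  have hre : (fun i => (x i).re) = 0 := by
    refine eq_zero_of_dotProduct_eq_zero hA hirr hr hspec hw ?_ ?_
    · ext i
      simpa [toComplex, Matrix.mulVec, dotProduct] using congrArg Complex.re (congrFun hx i)
    · simpa [w', dotProduct] using congrArg Complex.re hwx
  have him : (fun i => (x i).im) = 0 := by
    refine eq_zero_of_dotProduct_eq_zero hA hirr hr hspec hw ?_ ?_
    · ext i
      simpa [toComplex, Matrix.mulVec, dotProduct] using congrArg Complex.im (congrFun hx i)
    · simpa [w', dotProduct] using congrArg Complex.im hwx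
  exact funext fun i => Complex.ext (congrFun hre i) (congrFun him i)

/-- The Perron–Frobenius theorem: the dominant eigenvalue of a nonsingular primitive matrix is
a positive number `r`, it has positive right and left eigenvectors, and `A ^ k / r ^ k` converges to
the rank one matrix that they span. -/
theorem perron_frobenius (hprim : Primitive A) (hdet : A.det ≠ 0) :
    ∃ (r : ℝ) (v w : Fin n → ℝ), 0 < r ∧ (∀ i, 0 < v i) ∧ (∀ i, 0 < w i) ∧ A *ᵥ v = r • v ∧
      v ≠ 0 ∧ ∀ i j, Tendsto (fun k : ℕ => (A ^ k) i j / r ^ k) atTop (𝓝 (v i * w j)) := by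
  have hA := hprim.nonneg
  have hirr := stronglyConnected_of_not_reducible hprim.irreducible
  obtain ⟨z, ⟨hz, hmax⟩, huniq⟩ := hprim.existsUnique_max
  have hz0 : z ≠ 0 := by
    rintro rfl
    rw [spectrum.zero_mem_iff, Matrix.isUnit_iff_isUnit_det, isUnit_iff_ne_zero, det_toComplex,
      not_not, Complex.ofReal_eq_zero] at hz
    exact hdet hz
  obtain ⟨r, hr⟩ : ∃ r, r = ‖z‖ := ⟨_, rfl⟩
  have hr0 : 0 < r := by rw [hr]; exact norm_pos_iff.2 hz0
  rw [← hr] at hmax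
  have hT : toComplex Aᵀ = (toComplex A)ᵀ := rfl
  obtain ⟨v, hv, hAv⟩ := exists_pos_eigenvector hA hirr hr0 hmax ⟨z, hz, hr.symm⟩
  obtain ⟨w, hw, hAw⟩ := exists_pos_eigenvector (A := Aᵀ) (fun i j => hA j i) hirr.transpose hr0
    (by rw [hT, spectrum_transpose]; exact hmax)
    ⟨z, by rw [hT, spectrum_transpose]; exact hz, hr.symm⟩
  rw [Matrix.mulVec_transpose] at hAw
  have hn : ∃ i : Fin n, True := by
    obtain ⟨x, hx0, -⟩ := mem_spectrum_iff_exists_mulVec.1 hz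
    obtain ⟨i, -⟩ := Function.ne_iff.1 hx0
    exact ⟨i, trivial⟩
  obtain ⟨i₀, -⟩ := hn
  have hv0 : v ≠ 0 := fun h => (hv i₀).ne' (congrFun h i₀)
  have hrz : (r : ℂ) = z := huniq _ ⟨ofReal_mem_spectrum_of_mulVec hv0 hAv, by
    rw [Complex.norm_real, Real.norm_of_nonneg hr0.le]
    exact hmax⟩
  have hu : ∀ y ∈ spectrum ℂ (toComplex A), ‖y‖ = r → y = r := by
    intro y hy hyr
    rw [hrz]
    exact huniq y ⟨hy, by rw [hyr]; exact hmax⟩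
  have hwv : 0 < w ⬝ᵥ v :=
    Finset.sum_pos (fun i _ => mul_pos (hw i) (hv i)) ⟨i₀, Finset.mem_univ _⟩
  -- normalized so that `v w₁ᵀ` is a projection
  set w₁ := (w ⬝ᵥ v)⁻¹ • w with hw₁
  have hw₁pos : ∀ i, 0 < w₁ i := fun i => mul_pos (inv_pos.2 hwv) (hw i)
  have hw₁A : w₁ ᵥ* A = r • w₁ := by
    rw [hw₁, Matrix.smul_vecMul, hAw, smul_comm]
  have hw₁v : w₁ ⬝ᵥ v = 1 := by
    rw [hw₁, smul_dotProduct, smul_eq_mul, inv_mul_cancel₀ hwv.ne']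
  refine ⟨r, v, w₁, hr0, hv, hw₁pos, hAv, hv0, fun i j => ?_⟩
  set P := vecMulVec v w₁ with hP
  have hAP : ∀ k, A ^ k * P = r ^ k • P := by
    intro k
    rw [hP, Matrix.mul_vecMulVec, pow_mulVec_of_mulVec_eq_smul hAv, Matrix.smul_vecMulVec]
  have hPA : P * A = r • P := by
    rw [hP, Matrix.vecMulVec_mul, hw₁A, Matrix.vecMulVec_smul]
  have hPP : P * P = P := by
    rw [hP, Matrix.vecMulVec_mul_vecMulVec, hw₁v, one_smul]
  -- false for the exponent zero, hence the shift
  have hpow : ∀ k, (A - r • P) ^ (k + 1) = A ^ (k + 1) - r ^ (k + 1) • P := by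
    intro k
    induction k with
    | zero => simp
    | succ k ih =>
      rw [pow_succ, ih, Matrix.mul_sub, Matrix.sub_mul, Matrix.sub_mul, ← pow_succ,
        Matrix.mul_smul, hAP, Matrix.smul_mul, hPA, Matrix.mul_smul, Matrix.smul_mul, hPP,
        smul_smul, smul_smul, ← pow_succ, ← pow_succ', sub_self, sub_zero]
  have hlim := tendsto_pow_div_pow_real (A - r • P) hr0
    (norm_lt_of_mem_spectrum_sub hA hirr hr0 hmax hu hw₁pos hw₁A hw₁v) i j
  rw [← tendsto_add_atTop_iff_nat 1] at hlim ⊢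
  have h2 := hlim.add_const (v i * w₁ j)
  rw [zero_add] at h2
  refine h2.congr fun k => ?_
  rw [hpow]
  simp only [Matrix.sub_apply, Matrix.smul_apply, smul_eq_mul, hP, vecMulVec_apply]
  field_simp
  ring

end Perron

/-! ### Eventual positivity and the count of roots -/

theorem toComplex_injective {n : ℕ} :
    Function.Injective (toComplex : Matrix (Fin n) (Fin n) ℝ → Matrix (Fin n) (Fin n) ℂ) :=
  Matrix.map_injective Complex.ofReal_injective

theorem ofReal_mem_spectrum_iff {n : ℕ} {A : Matrix (Fin n) (Fin n) ℝ} {x : ℝ} :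
    (x : ℂ) ∈ spectrum ℂ (toComplex A) ↔ x ∈ spectrum ℝ A := by
  have h : algebraMap ℂ (Matrix (Fin n) (Fin n) ℂ) (x : ℂ) - toComplex A =
      toComplex (algebraMap ℝ (Matrix (Fin n) (Fin n) ℝ) x - A) := by
    ext i j
    simp only [toComplex, Matrix.sub_apply, Matrix.map_apply, Matrix.algebraMap_matrix_apply,
      Complex.ofReal_sub]
    split_ifs <;> simp
  rw [spectrum.mem_iff, spectrum.mem_iff, h, Matrix.isUnit_iff_isUnit_det,
    Matrix.isUnit_iff_isUnit_det, isUnit_iff_ne_zero, isUnit_iff_ne_zero, det_toComplex,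
    Complex.ofReal_ne_zero]

theorem conj_mem_spectrum {n : ℕ} {A : Matrix (Fin n) (Fin n) ℝ} {z : ℂ}
    (hz : z ∈ spectrum ℂ (toComplex A)) : conj z ∈ spectrum ℂ (toComplex A) := by
  obtain ⟨v, hv0, hv⟩ := mem_spectrum_iff_exists_mulVec.1 hz
  refine mem_spectrum_iff_exists_mulVec.2 ⟨conj ∘ v, ?_, ?_⟩
  · intro h
    exact hv0 (funext fun i => by simpa using congrFun h i)
  · rw [← map_conj_toComplex, map_conj_mulVec, hv]
    ext i
    simp

/-- A real `p`-th root of a primitive matrix is eventually positive exactly if its eigenvalue `m` at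
the Perron vector `v` is positive. If `X ^ k` is positive for consecutive `k`, then so are `m ^ k`
and `m ^ (k + 1)`. Conversely `X ^ (s + p k) = X ^ s A ^ k`, and `A ^ k` is asymptotically a multiple of the
Perron projection, on which `X` acts as a positive scalar. -/
theorem eventuallyPositive_iff {n p : ℕ} (hp : p ≠ 0) {A X : Matrix (Fin n) (Fin n) ℝ} {r : ℝ}
    {v w : Fin n → ℝ} (hr : 0 < r) (hv : ∀ i, 0 < v i) (hw : ∀ i, 0 < w i) (hv0 : v ≠ 0)
    (hlim : ∀ i j, Tendsto (fun k : ℕ => (A ^ k) i j / r ^ k) atTop (𝓝 (v i * w j)))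
    (hXp : X ^ p = A) {m : ℝ} (hXv : X *ᵥ v = m • v) :
    EventuallyPositive X ↔ 0 < m := by
  obtain ⟨i₀, -⟩ := Function.ne_iff.1 hv0
  have hpow := pow_mulVec_of_mulVec_eq_smul hXv
  constructor
  · rintro ⟨N, hN⟩
    have hpos : ∀ k ≥ N, 0 < m ^ k := by
      intro k hk
      have h1 : 0 < ((X ^ k) *ᵥ v) i₀ := by
        rw [Matrix.mulVec, dotProduct]
        exact Finset.sum_pos (fun j _ => mul_pos (hN k hk i₀ j) (hv j)) ⟨i₀, Finset.mem_univ _⟩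
      rw [hpow, Pi.smul_apply, smul_eq_mul] at h1
      exact pos_of_mul_pos_left h1 (hv i₀).le
    have h2 := hpos (N + 1) (by omega)
    rw [pow_succ'] at h2
    exact pos_of_mul_pos_left h2 (hpos N le_rfl).le
  · intro hm
    have hev : ∀ᶠ k : ℕ in atTop, ∀ s : Fin p, ∀ i j, 0 < (X ^ (s : ℕ) * A ^ k) i j := by
      rw [eventually_all]
      intro s
      rw [eventually_all]
      intro i
      rw [eventually_all]
      intro j
      have h1 : Tendsto (fun k : ℕ => ∑ l, (X ^ (s : ℕ)) i l * ((A ^ k) l j / r ^ k)) atTop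
          (𝓝 (∑ l, (X ^ (s : ℕ)) i l * (v l * w j))) :=
        tendsto_finsetSum _ fun l _ => (hlim l j).const_mul _
      have h2 : ∑ l, (X ^ (s : ℕ)) i l * (v l * w j) = m ^ (s : ℕ) * v i * w j := by
        have h3 := congrFun (hpow s) i
        rw [Matrix.mulVec, dotProduct, Pi.smul_apply, smul_eq_mul] at h3
        rw [← h3, Finset.sum_mul]
        exact Finset.sum_congr rfl fun l _ => by ring
      rw [h2] at h1
      have h4 : 0 < m ^ (s : ℕ) * v i * w j :=
        mul_pos (mul_pos (pow_pos hm _) (hv i)) (hw j)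
      filter_upwards [h1.eventually_const_lt h4] with k hk
      have h5 : ∑ l, (X ^ (s : ℕ)) i l * ((A ^ k) l j / r ^ k) =
          (X ^ (s : ℕ) * A ^ k) i j / r ^ k := by
        rw [Matrix.mul_apply, Finset.sum_div]
        exact Finset.sum_congr rfl fun l _ => by ring
      rw [h5] at hk
      exact (div_pos_iff_of_pos_right (pow_pos hr k)).1 hk
    obtain ⟨K, hK⟩ := eventually_atTop.1 hev
    refine ⟨p * K, fun k hk i j => ?_⟩
    have h1 := hK (k / p) ((Nat.le_div_iff_mul_le (Nat.pos_of_ne_zero hp)).2 (by linarith))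
      ⟨k % p, Nat.mod_lt _ (Nat.pos_of_ne_zero hp)⟩ i j
    rwa [← hXp, ← pow_mul, ← pow_add, Nat.mod_add_div] at h1

/-- The eventually positive primary roots of `A`, in terms of the branches chosen at the
eigenvalues: conjugate at conjugate eigenvalues, and positive at the Perron root. -/
theorem mem_evPosPrimaryRoots_iff {n p : ℕ} (hp : p ≠ 0) {A X : Matrix (Fin n) (Fin n) ℝ}
    (hdet : A.det ≠ 0) {r : ℝ}
    {v w : Fin n → ℝ} (hr : 0 < r) (hv : ∀ i, 0 < v i) (hw : ∀ i, 0 < w i) (hv0 : v ≠ 0)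
    (hAv : A *ᵥ v = r • v)
    (hlim : ∀ i j, Tendsto (fun k : ℕ => (A ^ k) i j / r ^ k) atTop (𝓝 (v i * w j))) :
    X ∈ evPosPrimaryRoots p A ↔
      ∃ μ : ℂ → ℂ, (∀ z ∈ spectrum ℂ (toComplex A), μ z ^ p = z) ∧
        (∀ z ∈ spectrum ℂ (toComplex A), μ (conj z) = conj (μ z)) ∧ 0 < (μ r).re ∧
        IsBranchRoot p (toComplex A) μ (toComplex X) := by
  have hdet' : (toComplex A).det ≠ 0 := by
    rw [det_toComplex]
    exact_mod_cast hdet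
  have hAv' : toComplex A *ᵥ (fun i => (v i : ℂ)) = (r : ℂ) • fun i => (v i : ℂ) := by
    rw [toComplex_mulVec, hAv]
    ext
    simp
  have hXv : ∀ μ : ℂ → ℂ, IsBranchRoot p (toComplex A) μ (toComplex X) →
      X *ᵥ v = (μ r).re • v := by
    intro μ hX
    have h1 := hX.mulVec_eq hAv'
    rw [toComplex_mulVec] at h1
    ext i
    simpa using congrArg Complex.re (congrFun h1 i)
  have key : X ∈ evPosPrimaryRoots p A ↔
      IsPrimaryRoot p (toComplex A) (toComplex X) ∧ EventuallyPositive X := Iff.rfl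
  have hXp : IsPrimaryRoot p (toComplex A) (toComplex X) → X ^ p = A := by
    intro h
    apply toComplex_injective
    rw [toComplex_pow]
    exact h.1
  rw [key]
  constructor
  · rintro ⟨hprim, hpos⟩
    obtain ⟨μ, hμ, hX⟩ := (isPrimaryRoot_iff hp hdet').1 hprim
    exact ⟨μ, hμ, (map_conj_eq_iff hX).1 (map_conj_toComplex X),
      (eventuallyPositive_iff hp hr hv hw hv0 hlim (hXp hprim) (hXv μ hX)).1 hpos, hX⟩
  · rintro ⟨μ, hμ, -, hpos, hX⟩
    have hprim := (isPrimaryRoot_iff hp hdet').2 ⟨μ, hμ, hX⟩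
    exact ⟨hprim, (eventuallyPositive_iff hp hr hv hw hv0 hlim (hXp hprim) (hXv μ hX)).2 hpos⟩

/-- The values at `z` that a choice of branches for a real root may take, if its value at the Perron
root `r` is to be positive: all `p`-th roots of `z`, only the real ones if `z` is real. -/
def admissibleRoots (p : ℕ) (r : ℝ) (z : ℂ) : Finset ℂ :=
  {w ∈ (Polynomial.nthRoots p z).toFinset | (z.im = 0 → w.im = 0) ∧ (z = r → 0 < w.re)}

theorem mem_admissibleRoots {p : ℕ} (hp : p ≠ 0) {r : ℝ} {z w : ℂ} :
    w ∈ admissibleRoots p r z ↔ w ^ p = z ∧ (z.im = 0 → w.im = 0) ∧ (z = r → 0 < w.re) := by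
  simp [admissibleRoots, Polynomial.mem_nthRoots (Nat.pos_of_ne_zero hp)]

theorem card_admissibleRoots_of_im_ne_zero {p : ℕ} (hp : p ≠ 0) (r : ℝ) {z : ℂ} (hz : z.im ≠ 0) :
    (admissibleRoots p r z).card = p := by
  have hz0 : z ≠ 0 := by
    rintro rfl
    simp at hz
  have hzr : z ≠ r := by
    rintro rfl
    simp at hz
  have h1 : admissibleRoots p r z = (Polynomial.nthRoots p z).toFinset := by
    simp [admissibleRoots, hz, hzr]
  have hζ := Complex.isPrimitiveRoot_exp p hp
  rw [h1, Multiset.toFinset_card_of_nodup (hζ.nthRoots_nodup hz0), hζ.card_nthRoots,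
    if_pos ⟨rootBranch p 0 z, rootBranch_pow hp 0 z⟩]

theorem mem_admissibleRoots_ofReal {p : ℕ} (hp : p ≠ 0) {r x : ℝ} {w : ℂ} :
    w ∈ admissibleRoots p r x ↔ ∃ y : ℝ, (y : ℂ) = w ∧ y ^ p = x ∧ (x = r → 0 < y) := by
  rw [mem_admissibleRoots hp]
  constructor
  · rintro ⟨h1, h2, h3⟩
    have hw : ((w.re : ℝ) : ℂ) = w := Complex.ext (by simp) (by simp [h2 (Complex.ofReal_im x)])
    refine ⟨w.re, hw, ?_, fun h => h3 (by rw [h])⟩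
    rw [← hw] at h1
    exact_mod_cast h1
  · rintro ⟨y, rfl, h1, h2⟩
    refine ⟨by exact_mod_cast h1, fun _ => Complex.ofReal_im y, fun h => ?_⟩
    rw [Complex.ofReal_re]
    exact h2 (by exact_mod_cast h)

theorem card_admissibleRoots_of_odd {p : ℕ} (hp : Odd p) {r : ℝ} (hr : 0 < r) (x : ℝ) :
    (admissibleRoots p r x).card = 1 := by
  have hp0 : p ≠ 0 := hp.pos.ne'
  obtain ⟨a, ha⟩ : ∃ a : ℝ, a ^ p = x := by
    rcases le_total 0 x with hx | hx
    · exact ⟨x ^ (1 / p : ℝ), by rw [one_div, Real.rpow_inv_natCast_pow hx hp0]⟩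
    · refine ⟨-(-x) ^ (1 / p : ℝ), ?_⟩
      rw [hp.neg_pow, one_div, Real.rpow_inv_natCast_pow (by linarith) hp0, neg_neg]
  rw [Finset.card_eq_one]
  refine ⟨a, ?_⟩
  ext w
  rw [mem_admissibleRoots_ofReal hp0, Finset.mem_singleton]
  constructor
  · rintro ⟨y, rfl, h1, -⟩
    rw [hp.strictMono_pow.injective (h1.trans ha.symm)]
  · rintro rfl
    refine ⟨a, rfl, ha, fun h => ?_⟩
    -- an odd power is positive only if its base is
    rw [← hp.pow_pos_iff, ha, h]
    exact hr

theorem card_admissibleRoots_self {p : ℕ} (hp0 : p ≠ 0) {r : ℝ} (hr : 0 < r) :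
    (admissibleRoots p r r).card = 1 := by
  have ha : (r ^ (1 / p : ℝ)) ^ p = r := by rw [one_div, Real.rpow_inv_natCast_pow hr.le hp0]
  have ha0 : 0 < r ^ (1 / p : ℝ) := Real.rpow_pos_of_pos hr _
  rw [Finset.card_eq_one]
  refine ⟨(r ^ (1 / p : ℝ) : ℝ), ?_⟩
  ext w
  rw [mem_admissibleRoots_ofReal hp0, Finset.mem_singleton]
  constructor
  · rintro ⟨y, rfl, h1, h2⟩
    rw [(pow_left_inj₀ (h2 rfl).le ha0.le hp0).1 (h1.trans ha.symm)]
  · rintro rfl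
    exact ⟨_, rfl, ha, fun _ => ha0⟩

theorem card_admissibleRoots_of_pos {p : ℕ} (hp : Even p) (hp0 : p ≠ 0) {r x : ℝ} (hx : 0 < x)
    (hxr : x ≠ r) : (admissibleRoots p r x).card = 2 := by
  have ha : (x ^ (1 / p : ℝ)) ^ p = x := by rw [one_div, Real.rpow_inv_natCast_pow hx.le hp0]
  have ha0 : 0 < x ^ (1 / p : ℝ) := Real.rpow_pos_of_pos hx _
  set a := x ^ (1 / p : ℝ)
  rw [Finset.card_eq_two]
  refine ⟨(a : ℝ), (-a : ℝ), ?_, ?_⟩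
  · rw [Ne, Complex.ofReal_inj]
    linarith
  ext w
  rw [mem_admissibleRoots_ofReal hp0, Finset.mem_insert, Finset.mem_singleton]
  constructor
  · rintro ⟨y, rfl, h1, -⟩
    rcases (pow_eq_pow_iff_of_ne_zero hp0).1 (h1.trans ha.symm) with h | h
    · exact Or.inl (by rw [h])
    · exact Or.inr (by rw [h.1])
  · rintro (rfl | rfl)
    · exact ⟨_, rfl, ha, fun h => absurd h hxr⟩
    · exact ⟨_, rfl, by rw [hp.neg_pow, ha], fun h => absurd h hxr⟩

theorem admissibleRoots_of_neg {p : ℕ} (hp : Even p) (hp0 : p ≠ 0) {r x : ℝ} (hx : x < 0) :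
    admissibleRoots p r x = ∅ := by
  rw [Finset.eq_empty_iff_forall_notMem]
  intro w hw
  obtain ⟨y, -, hy, -⟩ := (mem_admissibleRoots_ofReal hp0).1 hw
  linarith [hp.pow_nonneg y]

/-- A real root is determined by the values of its branches at the eigenvalues in the closed upper
half plane `T`, and these values can be prescribed freely among the admissible ones. -/
theorem exists_evPosPrimaryRoots_eq_image {n p : ℕ} (hp : p ≠ 0) {A : Matrix (Fin n) (Fin n) ℝ}
    (hprim : Primitive A) (hdet : A.det ≠ 0) (T : Finset ℂ)
    (hT : ∀ z, z ∈ T ↔ z ∈ spectrum ℂ (toComplex A) ∧ 0 ≤ z.im) :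
    ∃ r : ℝ, 0 < r ∧ (r : ℂ) ∈ T ∧ ∃ Ψ : (T → ℂ) → Matrix (Fin n) (Fin n) ℝ,
      evPosPrimaryRoots p A = Ψ '' ↑(Fintype.piFinset fun z : T => admissibleRoots p r z) ∧
      Set.InjOn Ψ ↑(Fintype.piFinset fun z : T => admissibleRoots p r z) := by
  classical
  obtain ⟨r, v, w, hr, hv, hw, hAv, hv0, hlim⟩ := perron_frobenius hprim hdet
  have hrT : (r : ℂ) ∈ T := (hT r).2 ⟨ofReal_mem_spectrum_of_mulVec hv0 hAv, by simp⟩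
  refine ⟨r, hr, hrT, ?_⟩
  have hmem := fun X => mem_evPosPrimaryRoots_iff (X := X) hp hdet hr hv hw hv0 hAv hlim
  choose G hG using exists_isBranchRoot p (toComplex A)
  -- extension of the values on `T` to the whole spectrum by conjugation
  let ext : (T → ℂ) → ℂ → ℂ := fun g z =>
    if h : z ∈ T then g ⟨z, h⟩ else if h : conj z ∈ T then conj (g ⟨conj z, h⟩) else 0
  have hext : ∀ g (z : T), ext g z = g z := by
    intro g z
    simp only [ext, dif_pos z.2]
  have hlow : ∀ z ∈ spectrum ℂ (toComplex A), z ∉ T → conj z ∈ T := by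
    intro z hz hzT
    have him : z.im < 0 := by
      by_contra! h
      exact hzT ((hT z).2 ⟨hz, h⟩)
    exact (hT _).2 ⟨conj_mem_spectrum hz, by rw [Complex.conj_im]; linarith⟩
  have hext' : ∀ g z (hz : z ∈ spectrum ℂ (toComplex A)) (hzT : z ∉ T),
      ext g z = conj (g ⟨conj z, hlow z hz hzT⟩) := by
    intro g z hz hzT
    simp only [ext, dif_neg hzT, dif_pos (hlow z hz hzT)]
  have hadm : ∀ g ∈ Fintype.piFinset fun z : T => admissibleRoots p r z,
      (∀ z ∈ spectrum ℂ (toComplex A), ext g z ^ p = z) ∧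
      (∀ z ∈ spectrum ℂ (toComplex A), ext g (conj z) = conj (ext g z)) ∧ 0 < (ext g r).re := by
    intro g hg
    have hg' := fun z => (mem_admissibleRoots hp).1 (Fintype.mem_piFinset.1 hg z)
    refine ⟨fun z hz => ?_, fun z hz => ?_, ?_⟩
    · by_cases hzT : z ∈ T
      · rw [hext g ⟨z, hzT⟩]
        exact (hg' ⟨z, hzT⟩).1
      · rw [hext' g z hz hzT, ← map_pow, (hg' ⟨conj z, _⟩).1, Complex.conj_conj]
    · by_cases hzT : z ∈ T
      · rw [hext g ⟨z, hzT⟩]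
        by_cases hcT : conj z ∈ T
        · have h1 := ((hT z).1 hzT).2
          have h2 := ((hT _).1 hcT).2
          rw [Complex.conj_im] at h2
          have him : z.im = 0 := by linarith
          have hzz : conj z = z := Complex.conj_eq_iff_im.2 him
          rw [hzz, hext g ⟨z, hzT⟩]
          exact (Complex.conj_eq_iff_im.2 ((hg' ⟨z, hzT⟩).2.1 him)).symm
        · rw [hext' g _ (conj_mem_spectrum hz) hcT]
          simp only [Complex.conj_conj]
      · rw [hext' g z hz hzT, Complex.conj_conj]
        exact hext g ⟨conj z, hlow z hz hzT⟩
    · rw [hext g ⟨r, hrT⟩]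
      exact (hg' ⟨r, hrT⟩).2.2 rfl
  let Ψ : (T → ℂ) → Matrix (Fin n) (Fin n) ℝ := fun g => (G (ext g)).map Complex.re
  have hre : ∀ X : Matrix (Fin n) (Fin n) ℝ, (toComplex X).map Complex.re = X := by
    intro X
    ext i j
    simp [toComplex]
  have hΨ : ∀ g ∈ Fintype.piFinset fun z : T => admissibleRoots p r z,
      toComplex (Ψ g) = G (ext g) := by
    intro g hg
    obtain ⟨Y, hY⟩ := exists_toComplex_eq ((map_conj_eq_iff (hG (ext g))).2 (hadm g hg).2.1)
    simp only [Ψ]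
    rw [← hY, hre]
  refine ⟨Ψ, ?_, ?_⟩
  · ext X
    rw [hmem]
    constructor
    · rintro ⟨μ, hμ, hconj, hpos, hX⟩
      let g : T → ℂ := fun z => μ z
      refine ⟨g, ?_, ?_⟩
      · rw [Finset.mem_coe, Fintype.mem_piFinset]
        intro z
        have hz := ((hT z).1 z.2).1
        refine (mem_admissibleRoots hp).2 ⟨hμ z hz, fun him => ?_,
          fun h => by simpa only [g, h] using hpos⟩
        have h1 := hconj z hz
        rw [Complex.conj_eq_iff_im.2 him] at h1
        exact Complex.conj_eq_iff_im.1 h1.symm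
      · have heq : Set.EqOn μ (ext g) (spectrum ℂ (toComplex A)) := by
          intro z hz
          by_cases hzT : z ∈ T
          · exact (hext g ⟨z, hzT⟩).symm
          · rw [hext' g z hz hzT]
            simp only [g]
            rw [hconj z hz, Complex.conj_conj]
        simp only [Ψ]
        rw [(hG _).unique (hX.congr heq), hre]
    · rintro ⟨g, hg, rfl⟩
      obtain ⟨h1, h2, h3⟩ := hadm g hg
      exact ⟨ext g, h1, h2, h3, by rw [hΨ g hg]; exact hG _⟩
  · intro g hg g' hg' h
    have h1 := congrArg toComplex h
    rw [hΨ g hg, hΨ g' hg'] at h1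
    have h2 := (hG (ext g)).eqOn (h1 ▸ hG (ext g'))
    funext z
    rw [← hext g z, ← hext g' z]
    exact h2 ((hT z).1 z.2).1

end

end MatrixRoot

open MatrixRoot in
theorem theorem3p4 {n : ℕ} (A : Matrix (Fin n) (Fin n) ℝ)
    (hA : MatrixRoot.Primitive A) (hdet : A.det ≠ 0)
    (r₁ r₂ c : ℕ)
    (hr₁ : {x : ℝ | x ∈ spectrum ℝ A ∧ 0 < x}.ncard = r₁)
    (hr₂ : {x : ℝ | x ∈ spectrum ℝ A ∧ x < 0}.ncard = r₂)
    (hc : {z : ℂ | z ∈ spectrum ℂ (MatrixRoot.toComplex A) ∧ 0 < z.im}.ncard = c)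
    (p : ℕ) (hp : 1 < p) :
    (Even p → r₂ = 0 → (MatrixRoot.evPosPrimaryRoots p A).ncard = 2 ^ (r₁ - 1) * p ^ c) ∧
    (Even p → 0 < r₂ → MatrixRoot.evPosPrimaryRoots p A = ∅) ∧
    (Odd p → (MatrixRoot.evPosPrimaryRoots p A).ncard = p ^ c) := by
  classical
  have hp0 : p ≠ 0 := by omega
  let S : Finset ℂ := (Matrix.finite_spectrum (toComplex A)).toFinset
  have hS : ∀ z, z ∈ S ↔ z ∈ spectrum ℂ (toComplex A) := by simp [S]
  let T : Finset ℂ := {z ∈ S | 0 ≤ z.im}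
  have hT : ∀ z, z ∈ T ↔ z ∈ spectrum ℂ (toComplex A) ∧ 0 ≤ z.im := by simp [T, hS]
  obtain ⟨r, hr, hrT, Ψ, himage, hinj⟩ := exists_evPosPrimaryRoots_eq_image hp0 hA hdet T hT
  let R : Finset ℂ := {z ∈ T | ¬ 0 < z.im}
  have hR : ∀ z ∈ R, ∃ x : ℝ, x ∈ spectrum ℝ A ∧ (x : ℂ) = z := by
    intro z hz
    obtain ⟨h1, h2⟩ := Finset.mem_filter.1 hz
    obtain ⟨h3, h4⟩ := (hT z).1 h1
    have h5 : ((z.re : ℝ) : ℂ) = z := Complex.ext (by simp) (by simp; linarith)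
    exact ⟨z.re, by rwa [← ofReal_mem_spectrum_iff, h5], h5⟩
  have hR' : ∀ x : ℝ, (x : ℂ) ∈ R ↔ x ∈ spectrum ℝ A := by
    intro x
    simp [R, hT, ofReal_mem_spectrum_iff]
  have hupper : ({z ∈ T | 0 < z.im} : Finset ℂ).card = c := by
    rw [← hc, ← Set.ncard_coe_finset]
    congr 1
    ext z
    simp only [Finset.coe_filter, hT, Set.mem_ofPred_eq]
    exact ⟨fun h => ⟨h.1.1, h.2⟩, fun h => ⟨⟨h.1, h.2.le⟩, h.2⟩⟩
  have hcount : (evPosPrimaryRoots p A).ncard =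
      (∏ z ∈ R, (admissibleRoots p r z).card) * p ^ c := by
    rw [himage, hinj.ncard_image, Set.ncard_coe_finset, Fintype.card_piFinset,
      Finset.prod_coe_sort T fun z => (admissibleRoots p r z).card,
      ← Finset.prod_filter_mul_prod_filter_not T fun z => 0 < z.im, mul_comm]
    congr 1
    rw [Finset.prod_congr rfl fun z hz =>
      card_admissibleRoots_of_im_ne_zero hp0 r (Finset.mem_filter.1 hz).2.ne',
      Finset.prod_const, hupper]
  have hfin : (spectrum ℝ A).Finite := Matrix.finite_spectrum A
  have hne0 : ∀ x ∈ spectrum ℝ A, x ≠ 0 := by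
    rintro x hx rfl
    rw [spectrum.zero_mem_iff, Matrix.isUnit_iff_isUnit_det, isUnit_iff_ne_zero] at hx
    exact hx hdet
  refine ⟨fun hpe hr0 => ?_, fun hpe hr0 => ?_, fun hpo => ?_⟩
  · have hpos : ∀ x ∈ spectrum ℝ A, 0 < x := by
      intro x hx
      by_contra! h
      rw [hr0, Set.ncard_eq_zero (hfin.subset fun x hx => hx.1)] at hr₂
      exact Set.eq_empty_iff_forall_notMem.1 hr₂ x ⟨hx, lt_of_le_of_ne h (hne0 x hx)⟩
    have hrR : (r : ℂ) ∈ R := by simp [R, hrT]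
    have hcard : R.card = r₁ := by
      rw [← hr₁, ← Set.ncard_coe_finset, ← Set.ncard_image_of_injective _ Complex.ofReal_injective]
      congr 1
      ext z
      constructor
      · intro hz
        obtain ⟨x, hx, rfl⟩ := hR z hz
        exact ⟨x, ⟨hx, hpos x hx⟩, rfl⟩
      · rintro ⟨x, hx, rfl⟩
        exact (hR' x).2 hx.1
    rw [hcount, ← Finset.mul_prod_erase R _ hrR, card_admissibleRoots_self hp0 hr, one_mul]
    congr 1
    rw [← hcard, ← Finset.card_erase_of_mem hrR, ← Finset.prod_const]
    refine Finset.prod_congr rfl fun z hz => ?_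
    obtain ⟨hzr, hzR⟩ := Finset.mem_erase.1 hz
    obtain ⟨x, hx, rfl⟩ := hR z hzR
    exact card_admissibleRoots_of_pos hpe hp0 (hpos x hx) fun h => hzr (by rw [h])
  · obtain ⟨x, hx, hx0⟩ := Set.nonempty_of_ncard_ne_zero (hr₂.trans_ne hr0.ne')
    have hxT : (x : ℂ) ∈ T := (Finset.mem_filter.1 ((hR' x).2 hx)).1
    rw [himage, Set.image_eq_empty, Finset.coe_eq_empty, Fintype.piFinset_eq_empty]
    exact ⟨⟨x, hxT⟩, admissibleRoots_of_neg hpe hp0 hx0⟩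
  · rw [hcount, Finset.prod_eq_one, one_mul]
    intro z hz
    obtain ⟨x, -, rfl⟩ := hR z hz
    exact card_admissibleRoots_of_odd hpo hr x
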